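/- All functions are real functions on $[0,1]$. For $f:[0,1]\to[0,\infty)$ write $\int f:=\int_0^1 f(x)\,dx$. Let $\mathcal E$ be the set of decreasing $f:[0,1]\to[0,\infty)$ with $f(0)=1$ and $\int f>0$; let $\mathcal C$ be the set of continuous $f\in\mathcal E$ with $f(1)=0$, and $\mathcal D$ the set of strictly decreasing $f\in\mathcal C$. For $f\in\mathcal E$ let $f^*(y):=\sup\{x\in[0,1]: f(x)\ge y\}$ for $y\in[0,1]$, and $$(Tf)(x):=\frac{\int_x^1 f^*(y)\,dy}{\int f}\qquad(x\in[0,1]).$$ Let $\mathcal K$ be the set of convex $g\in\mathcal C$ with $\int g\ge\frac15$ and $\sup\{\alpha\ge0:\ \alpha-x\le\alpha g(x)\text{ for all }x\in[0,1]\}\ge\frac15$. A sign switch of a continuous $\Delta:[a,b]\to\mathbb R$ is an interval $[c,d]$ with $a<c\le d<b$ on which $\Delta$ vanishes, such that for some $\delta\in(0,\min\{c-a,b-d\}]$ one has $\Delta(c-x)\,\Delta(d+x)<0$ for all $x\in(0,\delta]$. For $f,g\in\mathcal D$ let $\chi(f,g)\in\mathbb N_0\cup\{\infty\}$ be the supremum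 over all $a,b>0$ of the number of sign switches of $x\mapsto f(ax)-b\,g(x)$ on $[0,\min\{1,\frac1a\}]$. We say that $f$ dominates $g$, written $g\lhd f$, if $f,g\in\mathcal D$, $\chi(f,g)=2$ and $g\le f$ on $[0,1]$. **Theorem.** Let $h_n:=T^n1$ for $n\ge0$, where $1$ is the constant function on $[0,1]$. Then $h_{n+1}\lhd h_n$ and $h_n\in\mathcal K$ for all $n\ge1$, and the sequence $(h_n)$ converges uniformly on $[0,1]$ to a function $h\in\mathcal K$. Moreover $Th=h$, and $h$ solves the iterative differential equation $-\gamma g'=g^{-1}$ with $\gamma=\int h>0$; that is, $h$ is a differentiable bijection of $[0,1]$ onto itself (with one-sided derivatives at the end points) and $-\bigl(\int h\bigr)\,h'(x)=h^{-1}(x)$ for all $x\in[0,1]$, where $h^{-1}$ is the compositional inverse of $h$. -/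

import Mathlib

open Set Filter

noncomputable section

namespace Stribola

/-! Functions on `[0,1]` are represented by functions `ℝ → ℝ`, of which only the values on
`Set.Icc 0 1` are ever used. -/

/-- The unit interval `[0,1]` as a set of reals. -/
abbrev I01 : Set ℝ := Icc (0 : ℝ) 1

/-- The area `∫₀¹ f`. -/
def area (f : ℝ → ℝ) : ℝ := ∫ x in (0 : ℝ)..1, f x

/-- Decreasing functions `[0,1] → [0,∞)` with value `1` at `0` and positive area
(measurability is automatic for decreasing functions). -/
def classE : Set (ℝ → ℝ) :=
  {f | (∀ x ∈ I01, 0 ≤ f x) ∧ AntitoneOn f I01 ∧ f 0 = 1 ∧ 0 < area f}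

/-- The continuous members of `classE` that vanish at `1`. -/
def classC : Set (ℝ → ℝ) :=
  {f | f ∈ classE ∧ ContinuousOn f I01 ∧ f 1 = 0}

/-- The strictly decreasing members of `classC`. -/
def classD : Set (ℝ → ℝ) :=
  {f | f ∈ classC ∧ StrictAntiOn f I01}

/-- The stride: `sup {α ≥ 0 | α - id ≤ α g on [0,1]}`. -/
def stride (g : ℝ → ℝ) : ℝ :=
  sSup {α : ℝ | 0 ≤ α ∧ ∀ x ∈ I01, α - x ≤ α * g x}

/-- Convex members of `classC` with stride and area at least `1/5`. -/
def classK : Set (ℝ → ℝ) :=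
  {g | g ∈ classC ∧ ConvexOn ℝ I01 g ∧ 1 / 5 ≤ stride g ∧ 1 / 5 ≤ area g}

/-- The pseudo-inverse `g*(y) = sup {x ∈ [0,1] | g x ≥ y}`. -/
def pseudoInv (g : ℝ → ℝ) (y : ℝ) : ℝ := sSup {x : ℝ | x ∈ I01 ∧ y ≤ g x}

/-- The operator `(T f)(x) = (∫ₓ¹ f*) / ∫₀¹ f`. -/
def T (f : ℝ → ℝ) (x : ℝ) : ℝ := (∫ t in x..1, pseudoInv f t) / area f

/-- The canonical iterates `hₙ = Tⁿ 1`. -/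
def canonicalIterate (n : ℕ) : ℝ → ℝ := T^[n] (fun _ => 1)

/-- The sign switches of `Δ` on `[a,b]`; the closed interval `[c,d]` is encoded as the
pair `(c,d)`. -/
def signSwitches (a b : ℝ) (Δ : ℝ → ℝ) : Set (ℝ × ℝ) :=
  {p | a < p.1 ∧ p.1 ≤ p.2 ∧ p.2 < b ∧ (∀ x ∈ Icc p.1 p.2, Δ x = 0) ∧
    ∃ δ : ℝ, 0 < δ ∧ δ ≤ min (p.1 - a) (b - p.2) ∧
      ∀ x ∈ Ioc 0 δ, Δ (p.1 - x) * Δ (p.2 + x) < 0}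

/-- The number of sign switches of `Δ` on `[a,b]`, in `ℕ ∪ {∞}`. -/
def numSwitches (a b : ℝ) (Δ : ℝ → ℝ) : ℕ∞ := (signSwitches a b Δ).encard

/-- The crossing number of `f` with `g`: the supremum over all `a, b > 0` of the number of
sign switches of `x ↦ f (a x) - b g x` on `[0, min {1, 1/a}]`. -/
def crossingNumber (f g : ℝ → ℝ) : ℕ∞ :=
  ⨆ (a : ℝ) (b : ℝ) (_ : 0 < a) (_ : 0 < b),
    numSwitches 0 (min 1 (1 / a)) (fun x => f (a * x) - b * g x)

/-- `f` dominates `g` (both in `classD`): their crossing number is `2` and `g ≤ f`. -/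
def Dominates (f g : ℝ → ℝ) : Prop :=
  f ∈ classD ∧ g ∈ classD ∧ crossingNumber f g = 2 ∧ ∀ x ∈ I01, g x ≤ f x

/-- `g : [0,1] → [0,1]` is a differentiable bijection (one-sided derivatives at the end points)
and solves `-γ g' = g⁻¹` on `[0,1]`, with `γ > 0` and `g⁻¹` the compositional inverse. -/
structure SolvesIDE (γ : ℝ) (g : ℝ → ℝ) : Prop where
  gamma_pos : 0 < γ
  bijOn : BijOn g I01 I01
  differentiableOn : DifferentiableOn ℝ g I01
  equation : ∀ x ∈ I01, -γ * derivWithin g I01 x = Function.invFunOn g I01 x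

end Stribola

end

/-!
The iterates `hₙ = Tⁿ 1` decrease pointwise, stay in `classK`, and their limit is a fixed point of
`T`; differentiating `T h = h` gives the differential equation.

*Monotonicity.* The order `g ≤ f` alone is not preserved by `T`; it has to be combined with a bound
on the number of sign changes. The bound used is `AtMostTwoAlternations f g`: no
`x ↦ f (a x) - b g x` takes four strictly alternating signs. Counting alternations instead of the
switches in `signSwitches` matters, because a difference of monotone functions can alternate in
sign without having any sign switch. Replacing `f, g` by their inverses preserves the bound
(`AtMostTwoAlternations.pseudoInv`), and so does integration: the mean value theorem loses one
alternation and the right end point restores it (`AtMostTwoAlternations.T`). If `T f < T g`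
somewhere, with `g ≤ f`, a small change of the coefficient `b` produces a fourth sign, so `T` also
preserves the order (`T_le_T`). The pair `(h₁, h₂)` satisfies the hypotheses since `h₁` is linear
and `h₂` convex. Finally the bound gives at most two sign switches, and two clean ones are found on
a suitable `f (a x) - b g x` with `a, b` slightly above `1` (`crossingNumber_eq_two`).

*The bounds by `1/5`.* One has `T f ≥ 1 - x / area f` and, by the layer cake formula,
`area (T f) = ∫ f² / (2 area f)` (`area_T`). For convex `f ≥ 1 - 5 x` with `area f ≥ 1/5`, comparison
with a piecewise linear function of the same area shows `∫ f² ≥ (2/5) area f`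
(`two_fifths_area_le`), so both bounds pass from `f` to `T f`.

*The limit.* The iterates `hₙ`, `n ≥ 2`, are `5`-Lipschitz, so the pointwise limit `h` is
continuous, and Dini's theorem gives uniform convergence. Pseudo-inverses converge pointwise along
decreasing sequences (`tendsto_pseudoInv`), so `T hₙ → T h` by dominated convergence and `T h = h`.
As a value of `T`, `h` is strictly decreasing, hence a bijection with continuous inverse `h*`, and
`h' = -h* / area h`.
-/

namespace Stribola

open MeasureTheory Topology

/-! ### The pseudo-inverse -/

section PseudoInverse

variable {f g : ℝ → ℝ} {x y : ℝ}

lemma zero_mem : (0 : ℝ) ∈ I01 := ⟨le_rfl, zero_le_one⟩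

lemma one_mem : (1 : ℝ) ∈ I01 := ⟨zero_le_one, le_rfl⟩

lemma classC.nonneg (hf : f ∈ classC) (hx : x ∈ I01) : 0 ≤ f x := hf.1.1 x hx

lemma classC.anti (hf : f ∈ classC) : AntitoneOn f I01 := hf.1.2.1

lemma classC.zero (hf : f ∈ classC) : f 0 = 1 := hf.1.2.2.1

lemma classC.one (hf : f ∈ classC) : f 1 = 0 := hf.2.2

lemma classC.area_pos (hf : f ∈ classC) : 0 < area f := hf.1.2.2.2

lemma classC.cont (hf : f ∈ classC) : ContinuousOn f I01 := hf.2.1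

lemma classC.le_one (hf : f ∈ classC) (hx : x ∈ I01) : f x ≤ 1 :=
  classC.zero hf ▸ classC.anti hf zero_mem hx hx.1

lemma bddAbove_superlevel (f : ℝ → ℝ) (y : ℝ) : BddAbove {x : ℝ | x ∈ I01 ∧ y ≤ f x} :=
  ⟨1, fun _ h => h.1.2⟩

lemma le_pseudoInv (hx : x ∈ I01) (h : y ≤ f x) : x ≤ pseudoInv f y :=
  le_csSup (bddAbove_superlevel f y) ⟨hx, h⟩

lemma pseudoInv_mem (h0 : y ≤ f 0) : pseudoInv f y ∈ I01 :=
  ⟨le_pseudoInv zero_mem h0, csSup_le ⟨0, zero_mem, h0⟩ fun _ h => h.1.2⟩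

lemma pseudoInv_mono (hg : ∀ x ∈ I01, g x ≤ f x) (h0 : y ≤ g 0) :
    pseudoInv g y ≤ pseudoInv f y :=
  csSup_le_csSup (bddAbove_superlevel f y) ⟨0, zero_mem, h0⟩
    fun x hx => ⟨hx.1, hx.2.trans (hg x hx.1)⟩

/-- The supremum defining the pseudo-inverse is attained, so it is a right inverse. -/
lemma apply_pseudoInv (hf : f ∈ classC) (hy : y ∈ I01) : f (pseudoInv f y) = y := by
  have h0 : y ≤ f 0 := classC.zero hf ▸ hy.2
  have hcl : IsClosed {x : ℝ | x ∈ I01 ∧ y ≤ f x} :=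
    (classC.cont hf).preimage_isClosed_of_isClosed isClosed_Icc isClosed_Ici
  have hmem := hcl.csSup_mem ⟨0, zero_mem, h0⟩ (bddAbove_superlevel f y)
  refine le_antisymm ?_ hmem.2
  obtain ⟨x, hx, hxy⟩ : y ∈ f '' I01 := by
    have := intermediate_value_Icc' zero_le_one (classC.cont hf)
    rw [classC.zero hf, classC.one hf] at this
    exact this hy
  exact (classC.anti hf hx hmem.1 (le_pseudoInv hx hxy.ge)).trans hxy.le

lemma classC.pinv_mem (hf : f ∈ classC) (hy : y ∈ I01) : pseudoInv f y ∈ I01 :=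
  pseudoInv_mem (classC.zero hf ▸ hy.2)

lemma pseudoInv_strictAntiOn (hf : f ∈ classC) : StrictAntiOn (pseudoInv f) I01 := by
  intro y hy z hz hyz
  by_contra! h
  have := classC.anti hf (classC.pinv_mem hf hy) (classC.pinv_mem hf hz) h
  rw [apply_pseudoInv hf hy, apply_pseudoInv hf hz] at this
  linarith

lemma pseudoInv_pos (hf : f ∈ classC) (hy : y ∈ I01) (h1 : y < 1) : 0 < pseudoInv f y :=
  (classC.pinv_mem hf one_mem).1.trans_lt (pseudoInv_strictAntiOn hf hy one_mem h1)

lemma pseudoInv_zero (hf : f ∈ classC) : pseudoInv f 0 = 1 :=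
  le_antisymm (classC.pinv_mem hf zero_mem).2 (le_pseudoInv one_mem (classC.one hf).ge)

lemma pseudoInv_apply (hf : f ∈ classD) (hx : x ∈ I01) : pseudoInv f (f x) = x := by
  have hfx : f x ∈ I01 := ⟨classC.nonneg hf.1 hx, classC.le_one hf.1 hx⟩
  exact hf.2.injOn (classC.pinv_mem hf.1 hfx) hx (apply_pseudoInv hf.1 hfx)

lemma pseudoInv_one (hf : f ∈ classD) : pseudoInv f 1 = 0 :=
  classC.zero hf.1 ▸ pseudoInv_apply hf zero_mem

/-- The inverse of a strictly decreasing `f` is continuous: preimages of closed sets are images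
of compact ones under `f`. -/
lemma pseudoInv_continuousOn (hf : f ∈ classD) : ContinuousOn (pseudoInv f) I01 := by
  rw [continuousOn_iff_isClosed]
  intro t ht
  refine ⟨f '' (t ∩ I01), ?_, ?_⟩
  · exact ((isCompact_Icc.inter_left ht).image_of_continuousOn
      ((classC.cont hf.1).mono inter_subset_right)).isClosed
  · ext y
    constructor
    · rintro ⟨h1, h2⟩
      exact ⟨⟨_, ⟨h1, classC.pinv_mem hf.1 h2⟩, apply_pseudoInv hf.1 h2⟩, h2⟩
    · rintro ⟨⟨x, hx, rfl⟩, h2⟩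
      refine ⟨?_, h2⟩
      rw [mem_preimage, pseudoInv_apply hf hx.2]
      exact hx.1

lemma intervalIntegrable_of_I01 {u : ℝ → ℝ} (hu : IntervalIntegrable u volume 0 1)
    (hx : x ∈ I01) (hy : y ∈ I01) : IntervalIntegrable u volume x y :=
  hu.mono_set (by
    rw [uIcc_of_le zero_le_one]
    exact uIcc_subset_Icc hx hy)

lemma pseudoInv_intervalIntegrable (hf : f ∈ classC) (hx : x ∈ I01) (hy : y ∈ I01) :
    IntervalIntegrable (pseudoInv f) volume x y :=
  intervalIntegrable_of_I01 (AntitoneOn.intervalIntegrable (by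
    rw [uIcc_of_le zero_le_one]; exact (pseudoInv_strictAntiOn hf).antitoneOn)) hx hy

lemma classC.intervalIntegrable (hf : f ∈ classC) : IntervalIntegrable f volume 0 1 :=
  ContinuousOn.intervalIntegrable (by rw [uIcc_of_le zero_le_one]; exact classC.cont hf)

/-- Layer cake: both sides compute the integral of `t ^ k` over the region below the
graph of `f`. -/
lemma integral_pow_mul_pseudoInv (hf : f ∈ classC) (k : ℕ) :
    ∫ t in (0 : ℝ)..1, t ^ k * pseudoInv f t = ∫ x in (0 : ℝ)..1, f x ^ (k + 1) / (k + 1) := by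
  have hmeas : AEMeasurable f (volume.restrict (Ioc (0 : ℝ) 1)) :=
    (classC.intervalIntegrable hf).1.1.aemeasurable
  have hmeas' : AEMeasurable (pseudoInv f) (volume.restrict (Ioc (0 : ℝ) 1)) :=
    (pseudoInv_intervalIntegrable hf zero_mem one_mem).1.1.aemeasurable
  have hnn : ∀ᵐ x ∂volume.restrict (Ioc (0 : ℝ) 1), 0 ≤ f x :=
    (ae_restrict_iff' measurableSet_Ioc).2
      (Eventually.of_forall fun x hx => classC.nonneg hf ⟨hx.1.le, hx.2⟩)
  have key := lintegral_comp_eq_lintegral_meas_le_mul (volume.restrict (Ioc (0 : ℝ) 1))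
    (f := f) (g := fun t => t ^ k) hnn hmeas (fun t _ => by
      exact (continuous_pow k).intervalIntegrable 0 t)
    ((ae_restrict_iff' measurableSet_Ioi).2
      (Eventually.of_forall fun t ht => pow_nonneg (le_of_lt ht) k))
  simp only [integral_pow] at key
  have hsplit : Ioi (0 : ℝ) = Ioc 0 1 ∪ Ioi 1 := (Ioc_union_Ioi_eq_Ioi zero_le_one).symm
  rw [hsplit, lintegral_union measurableSet_Ioi
    (Set.disjoint_left.2 fun x h1 h2 => not_lt.2 h1.2 h2)] at key
  have hz : ∫⁻ t in Ioi (1 : ℝ), (volume.restrict (Ioc (0 : ℝ) 1)) {a | t ≤ f a} *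
      ENNReal.ofReal (t ^ k) = 0 := by
    rw [← lintegral_zero (μ := volume.restrict (Ioi (1 : ℝ)))]
    refine setLIntegral_congr_fun measurableSet_Ioi fun t ht => ?_
    have : (volume.restrict (Ioc (0 : ℝ) 1)) {a | t ≤ f a} = 0 := by
      have h : ∀ᵐ a ∂volume.restrict (Ioc (0 : ℝ) 1), ¬ t ≤ f a :=
        (ae_restrict_iff' measurableSet_Ioc).2 (Eventually.of_forall fun x hx =>
          not_le.2 ((classC.le_one hf ⟨hx.1.le, hx.2⟩).trans_lt ht))
      simpa only [ae_iff, not_not] using h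
    simp [this]
  have hw : ∫⁻ t in Ioc (0 : ℝ) 1, (volume.restrict (Ioc (0 : ℝ) 1)) {a | t ≤ f a} *
      ENNReal.ofReal (t ^ k) =
      ∫⁻ t in Ioc (0 : ℝ) 1, ENNReal.ofReal (t ^ k * pseudoInv f t) := by
    refine setLIntegral_congr_fun measurableSet_Ioc fun t ht => ?_
    have ht' : t ∈ I01 := ⟨ht.1.le, ht.2⟩
    have hp := classC.pinv_mem hf ht'
    have hae : ({a | t ≤ f a} : Set ℝ) =ᵐ[volume.restrict (Ioc (0 : ℝ) 1)]
        Ioc 0 (pseudoInv f t) := by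
      refine (ae_restrict_iff' measurableSet_Ioc).2 (Eventually.of_forall fun x hx => ?_)
      have hx' : x ∈ I01 := ⟨hx.1.le, hx.2⟩
      refine propext ⟨fun h => ⟨hx.1, le_pseudoInv hx' h⟩, fun h => ?_⟩
      have := classC.anti hf hx' hp h.2
      rw [apply_pseudoInv hf ht'] at this
      exact this
    have : (volume.restrict (Ioc (0 : ℝ) 1)) {a | t ≤ f a} =
        ENNReal.ofReal (pseudoInv f t) := by
      rw [measure_congr hae, Measure.restrict_apply measurableSet_Ioc,
        inter_eq_left.2 (Ioc_subset_Ioc_right hp.2), Real.volume_Ioc, sub_zero]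
    simp only [this]
    rw [← ENNReal.ofReal_mul hp.1, mul_comm]
  rw [hz, add_zero, hw] at key
  rw [intervalIntegral.integral_of_le zero_le_one, intervalIntegral.integral_of_le zero_le_one,
    integral_eq_lintegral_of_nonneg_ae, integral_eq_lintegral_of_nonneg_ae, ← key]
  · simp
  · filter_upwards [hnn] with x hx
    show 0 ≤ f x ^ (k + 1) / (k + 1)
    positivity
  · exact ((hmeas.pow_const _).div_const _).aestronglyMeasurable
  · refine (ae_restrict_iff' measurableSet_Ioc).2 (Eventually.of_forall fun t ht => ?_)
    exact mul_nonneg (pow_nonneg ht.1.le k) (classC.pinv_mem hf ⟨ht.1.le, ht.2⟩).1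
  · exact (((measurable_id.pow_const k).aemeasurable).mul hmeas').aestronglyMeasurable

lemma integral_pseudoInv (hf : f ∈ classC) : ∫ t in (0 : ℝ)..1, pseudoInv f t = area f := by
  simpa [area] using integral_pow_mul_pseudoInv hf 0

lemma integral_mul_pseudoInv (hf : f ∈ classC) :
    ∫ t in (0 : ℝ)..1, t * pseudoInv f t = (∫ x in (0 : ℝ)..1, f x ^ 2) / 2 := by
  have := integral_pow_mul_pseudoInv hf 1
  simp only [pow_one, Nat.cast_one, one_add_one_eq_two] at this
  rw [this, intervalIntegral.integral_div]

end PseudoInverse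

/-! ### The operator `T` -/

section OperatorT

variable {f g : ℝ → ℝ} {x y : ℝ}

lemma area_congr (h : EqOn f g I01) : area f = area g :=
  intervalIntegral.integral_congr (by rw [uIcc_of_le zero_le_one]; exact h)

lemma T_sub_T (hf : f ∈ classC) (hx : x ∈ I01) (hy : y ∈ I01) :
    T f x - T f y = (∫ t in x..y, pseudoInv f t) / area f := by
  unfold T
  rw [← sub_div, ← intervalIntegral.integral_add_adjacent_intervals
    (pseudoInv_intervalIntegrable hf hx hy) (pseudoInv_intervalIntegrable hf hy one_mem),
    add_sub_cancel_right]

lemma T_one (f : ℝ → ℝ) : T f 1 = 0 := by simp [T]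

lemma T_zero (hf : f ∈ classC) : T f 0 = 1 := by
  rw [T, integral_pseudoInv hf, div_self (classC.area_pos hf).ne']

lemma T_strictAntiOn (hf : f ∈ classC) : StrictAntiOn (T f) I01 := by
  intro x hx y hy hxy
  rw [← sub_pos, T_sub_T hf hx hy]
  refine div_pos ?_ (classC.area_pos hf)
  exact intervalIntegral.intervalIntegral_pos_of_pos_on (pseudoInv_intervalIntegrable hf hx hy)
    (fun t ht => pseudoInv_pos hf ⟨hx.1.trans ht.1.le, ht.2.le.trans hy.2⟩
      (ht.2.trans_le hy.2)) hxy

lemma T_sub_T_le (hf : f ∈ classC) (hx : x ∈ I01) (hy : y ∈ I01) (hxy : x ≤ y) :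
    T f x - T f y ≤ (y - x) / area f := by
  rw [T_sub_T hf hx hy]
  refine div_le_div_of_nonneg_right ?_ (classC.area_pos hf).le
  calc ∫ t in x..y, pseudoInv f t ≤ ∫ _ in x..y, (1 : ℝ) :=
        intervalIntegral.integral_mono_on hxy (pseudoInv_intervalIntegrable hf hx hy)
          intervalIntegrable_const
          fun t ht => (classC.pinv_mem hf ⟨hx.1.trans ht.1, ht.2.trans hy.2⟩).2
    _ = y - x := by simp

lemma T_lipschitz (hf : f ∈ classC) (hx : x ∈ I01) (hy : y ∈ I01) :
    |T f x - T f y| ≤ (area f)⁻¹ * |x - y| := by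
  rw [inv_mul_eq_div]
  rcases le_total x y with h | h
  · rw [abs_of_nonneg (sub_nonneg.2 ((T_strictAntiOn hf).antitoneOn hx hy h)),
      abs_of_nonpos (sub_nonpos.2 h), neg_sub]
    exact T_sub_T_le hf hx hy h
  · rw [abs_sub_comm, abs_of_nonneg (sub_nonneg.2 ((T_strictAntiOn hf).antitoneOn hy hx h)),
      abs_of_nonneg (sub_nonneg.2 h)]
    exact T_sub_T_le hf hy hx h

lemma continuousOn_of_lipschitz {u : ℝ → ℝ} {s : Set ℝ} {C : ℝ}
    (h : ∀ x ∈ s, ∀ y ∈ s, |u x - u y| ≤ C * |x - y|) : ContinuousOn u s := by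
  have : LipschitzOnWith (Real.toNNReal C) u s :=
    LipschitzOnWith.of_dist_le_mul fun x hx y hy => by
      rw [Real.dist_eq, Real.dist_eq]
      exact (h x hx y hy).trans
        (mul_le_mul_of_nonneg_right (Real.le_coe_toNNReal C) (abs_nonneg _))
  exact this.continuousOn

lemma T_continuousOn (hf : f ∈ classC) : ContinuousOn (T f) I01 :=
  continuousOn_of_lipschitz fun _ hx _ hy => T_lipschitz hf hx hy

/-- A strictly decreasing continuous function from `1` to `0` belongs to `classD`: the remaining
conditions are automatic. -/
lemma mem_classD (h0 : f 0 = 1) (h1 : f 1 = 0) (hc : ContinuousOn f I01)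
    (hs : StrictAntiOn f I01) : f ∈ classD := by
  refine ⟨⟨⟨fun x hx => ?_, hs.antitoneOn, h0, ?_⟩, hc, h1⟩, hs⟩
  · exact h1 ▸ hs.antitoneOn hx one_mem hx.2
  · refine intervalIntegral.intervalIntegral_pos_of_pos_on
      (ContinuousOn.intervalIntegrable (by rwa [uIcc_of_le zero_le_one])) (fun t ht => ?_)
      zero_lt_one
    exact h1 ▸ hs ⟨ht.1.le, ht.2.le⟩ one_mem ht.2

lemma classD.pos (hf : f ∈ classD) (hx : x ∈ I01) (h1 : x < 1) : 0 < f x :=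
  classC.one hf.1 ▸ hf.2 hx one_mem h1

lemma T_mem_classD (hf : f ∈ classC) : T f ∈ classD :=
  mem_classD (T_zero hf) (T_one f) (T_continuousOn hf) (T_strictAntiOn hf)

lemma one_sub_div_le_T (hf : f ∈ classC) (hx : x ∈ I01) : 1 - x / area f ≤ T f x := by
  have := T_sub_T_le hf zero_mem hx hx.1
  rw [T_zero hf, sub_zero] at this
  linarith

lemma hasDerivWithinAt_T (hf : f ∈ classD) (hx : x ∈ I01) :
    HasDerivWithinAt (T f) (-pseudoInv f x / area f) I01 x := by
  have hc := pseudoInv_continuousOn hf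
  have : Fact (x ∈ Icc (0 : ℝ) 1) := ⟨hx⟩
  have := intervalIntegral.integral_hasDerivWithinAt_left (s := Icc 0 1) (t := Icc 0 1)
    (pseudoInv_intervalIntegrable hf.1 hx one_mem)
    (hc.stronglyMeasurableAtFilter_nhdsWithin measurableSet_Icc x) (hc x hx)
  exact this.div_const _

lemma hasDerivAt_T (hf : f ∈ classD) (hx : x ∈ Ioo (0 : ℝ) 1) :
    HasDerivAt (T f) (-pseudoInv f x / area f) x :=
  (hasDerivWithinAt_T hf (Ioo_subset_Icc_self hx)).hasDerivAt (Icc_mem_nhds hx.1 hx.2)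

lemma T_convexOn (hf : f ∈ classD) : ConvexOn ℝ I01 (T f) := by
  have hD : ∀ x ∈ Ioo (0 : ℝ) 1, deriv (T f) x = -pseudoInv f x / area f :=
    fun x hx => (hasDerivAt_T hf hx).deriv
  refine MonotoneOn.convexOn_of_deriv (convex_Icc 0 1) (T_continuousOn hf.1) ?_ ?_
  · rw [interior_Icc]
    exact fun x hx => (hasDerivAt_T hf hx).differentiableAt.differentiableWithinAt
  · rw [interior_Icc]
    intro x hx y hy hxy
    rw [hD x hx, hD y hy]
    refine div_le_div_of_nonneg_right ?_ (classC.area_pos hf.1).le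
    exact neg_le_neg ((pseudoInv_strictAntiOn hf.1).antitoneOn (Ioo_subset_Icc_self hx)
      (Ioo_subset_Icc_self hy) hxy)

/-- The area of `T f` equals `∫ f² / (2 ∫ f)`: integrate by parts, then use the layer cake
formula with weight `t`. -/
lemma area_T (hf : f ∈ classD) : area (T f) = (∫ x in (0 : ℝ)..1, f x ^ 2) / (2 * area f) := by
  have h := intervalIntegral.integral_mul_deriv_eq_deriv_mul_of_hasDerivAt
    (a := 0) (b := 1) (u := T f) (v := fun x => x) (u' := fun x => -pseudoInv f x / area f)
    (v' := fun _ => 1)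
    (by rw [uIcc_of_le zero_le_one]; exact T_continuousOn hf.1) continuousOn_id
    (by
      rw [min_eq_left zero_le_one, max_eq_right zero_le_one]
      exact fun x hx => hasDerivAt_T hf hx)
    (fun x _ => hasDerivAt_id x)
    ((pseudoInv_intervalIntegrable hf.1 zero_mem one_mem).neg.div_const _)
    intervalIntegrable_const
  have h2 : ∫ x in (0 : ℝ)..1, -pseudoInv f x / area f * x =
      -((∫ x in (0 : ℝ)..1, f x ^ 2) / 2) / area f := by
    rw [← integral_mul_pseudoInv hf.1, ← intervalIntegral.integral_neg,
      ← intervalIntegral.integral_div]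
    exact intervalIntegral.integral_congr fun x _ => by ring
  rw [h2, T_one] at h
  simp only [mul_one, sub_zero, mul_zero, zero_sub] at h
  unfold area at h ⊢
  rw [h]
  have := (classC.area_pos hf.1).ne'
  unfold area at this
  field_simp
  try ring

end OperatorT

/-! ### Sign alternations and the operator `T` -/

section Alternation

variable {f g : ℝ → ℝ} {a b c x : ℝ}

/-- No function `x ↦ f (a x) - b g x` with `a, b > 0` takes strictly alternating signs at four
successive points of `[0, min {1, 1/a}]`. For differences of monotone functions this is stronger
than having at most two sign switches, since a function can alternate in sign without any clean
switch in the sense of `signSwitches`. -/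
def AtMostTwoAlternations (f g : ℝ → ℝ) : Prop :=
  ∀ a b : ℝ, 0 < a → 0 < b → ∀ x₀ x₁ x₂ x₃ : ℝ, 0 ≤ x₀ → x₀ < x₁ → x₁ < x₂ → x₂ < x₃ → x₃ ≤ 1 →
    a * x₃ ≤ 1 → ¬ ((f (a * x₀) - b * g x₀) * (f (a * x₁) - b * g x₁) < 0 ∧
      (f (a * x₁) - b * g x₁) * (f (a * x₂) - b * g x₂) < 0 ∧
      (f (a * x₂) - b * g x₂) * (f (a * x₃) - b * g x₃) < 0)

/-- The smaller of the two points `z` at which `a g z`, respectively `f (c z)`, takes the value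
`a ξ`. There `f (c z) - a g z` has the same sign as `f* (a ξ) - c g* ξ`. -/
noncomputable def transfer (f g : ℝ → ℝ) (a c ξ : ℝ) : ℝ := min (pseudoInv g ξ) (pseudoInv f (a * ξ) / c)

lemma transfer_mem (hf : f ∈ classD) (hg : g ∈ classD) (ha : 0 < a) (hc : 0 < c)
    (hx : x ∈ I01) (hax : a * x ≤ 1) :
    0 ≤ transfer f g a c x ∧ transfer f g a c x ≤ 1 ∧ c * transfer f g a c x ≤ 1 := by
  have hg' := classC.pinv_mem hg.1 hx
  have hf' := classC.pinv_mem hf.1 ⟨mul_nonneg ha.le hx.1, hax⟩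
  refine ⟨le_min hg'.1 (div_nonneg hf'.1 hc.le), (min_le_left _ _).trans hg'.2, ?_⟩
  calc c * transfer f g a c x ≤ c * (pseudoInv f (a * x) / c) :=
        mul_le_mul_of_nonneg_left (min_le_right _ _) hc.le
    _ = pseudoInv f (a * x) := mul_div_cancel₀ _ hc.ne'
    _ ≤ 1 := hf'.2

lemma transfer_strictAnti (hf : f ∈ classD) (hg : g ∈ classD) (ha : 0 < a) (hc : 0 < c)
    {y : ℝ} (hx : 0 ≤ x) (hxy : x < y) (hy : y ≤ 1) (hay : a * y ≤ 1) :
    transfer f g a c y < transfer f g a c x := by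
  have h := mul_lt_mul_of_pos_left hxy ha
  refine min_lt_min (pseudoInv_strictAntiOn hg.1 ⟨hx, hxy.le.trans hy⟩ ⟨hx.trans hxy.le, hy⟩ hxy)
    (div_lt_div_of_pos_right (pseudoInv_strictAntiOn hf.1 ?_ ?_ h) hc)
  · exact ⟨mul_nonneg ha.le hx, h.le.trans hay⟩
  · exact ⟨mul_nonneg ha.le (hx.trans hxy.le), hay⟩

lemma transfer_pos (hf : f ∈ classD) (hg : g ∈ classD) (ha : 0 < a) (hc : 0 < c)
    (hx : x ∈ I01) (hax : a * x ≤ 1)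
    (h : 0 < pseudoInv f (a * x) - c * pseudoInv g x) :
    0 < f (c * transfer f g a c x) - a * g (transfer f g a c x) := by
  have haI : a * x ∈ I01 := ⟨mul_nonneg ha.le hx.1, hax⟩
  have hg' := classC.pinv_mem hg.1 hx
  have hf' := classC.pinv_mem hf.1 haI
  have hz : transfer f g a c x = pseudoInv g x := by
    refine min_eq_left ?_
    rw [le_div_iff₀ hc]; linarith
  rw [hz, apply_pseudoInv hg.1 hx, sub_pos]
  calc a * x = f (pseudoInv f (a * x)) := (apply_pseudoInv hf.1 haI).symm
    _ < f (c * pseudoInv g x) := hf.2 ⟨mul_nonneg hc.le hg'.1, by linarith [hf'.2]⟩ hf'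
        (by linarith)

lemma transfer_neg (hf : f ∈ classD) (hg : g ∈ classD) (ha : 0 < a) (hc : 0 < c)
    (hx : x ∈ I01) (hax : a * x ≤ 1)
    (h : pseudoInv f (a * x) - c * pseudoInv g x < 0) :
    f (c * transfer f g a c x) - a * g (transfer f g a c x) < 0 := by
  have haI : a * x ∈ I01 := ⟨mul_nonneg ha.le hx.1, hax⟩
  have hg' := classC.pinv_mem hg.1 hx
  have hf' := classC.pinv_mem hf.1 haI
  have hlt : pseudoInv f (a * x) / c < pseudoInv g x := by
    rw [div_lt_iff₀ hc]; linarith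
  have hz : transfer f g a c x = pseudoInv f (a * x) / c := min_eq_right hlt.le
  rw [hz, mul_div_cancel₀ _ hc.ne', apply_pseudoInv hf.1 haI, sub_neg]
  refine mul_lt_mul_of_pos_left ?_ ha
  calc x = g (pseudoInv g x) := (apply_pseudoInv hg.1 hx).symm
    _ < g (pseudoInv f (a * x) / c) :=
        hg.2 ⟨div_nonneg hf'.1 hc.le, hlt.le.trans hg'.2⟩ hg' hlt

/-- Passing to inverse functions preserves the bound on alternations. -/
lemma AtMostTwoAlternations.pseudoInv (hN : AtMostTwoAlternations f g) (hf : f ∈ classD)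
    (hg : g ∈ classD) : AtMostTwoAlternations (pseudoInv f) (pseudoInv g) := by
  intro a c ha hc x₀ x₁ x₂ x₃ h0 h01 h12 h23 h3 ha3 ⟨hA, hB, hC⟩
  have hmem : ∀ x, x₀ ≤ x → x ≤ x₃ → x ∈ I01 ∧ a * x ≤ 1 := fun x hx hx' =>
    ⟨⟨h0.trans hx, hx'.trans h3⟩, (mul_le_mul_of_nonneg_left hx' ha.le).trans ha3⟩
  obtain ⟨m0, n0⟩ := hmem x₀ le_rfl (by linarith)
  obtain ⟨m1, n1⟩ := hmem x₁ (by linarith) (by linarith)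
  obtain ⟨m2, n2⟩ := hmem x₂ (by linarith) (by linarith)
  obtain ⟨m3, n3⟩ := hmem x₃ (by linarith) le_rfl
  have hprod : ∀ x y, x ∈ I01 → a * x ≤ 1 → y ∈ I01 → a * y ≤ 1 →
      (Stribola.pseudoInv f (a * x) - c * Stribola.pseudoInv g x) *
        (Stribola.pseudoInv f (a * y) - c * Stribola.pseudoInv g y) < 0 →
      (f (c * transfer f g a c y) - a * g (transfer f g a c y)) *
        (f (c * transfer f g a c x) - a * g (transfer f g a c x)) < 0 := by
    intro x y hx hax hy hay h
    rcases mul_neg_iff.1 h with ⟨h1, h2⟩ | ⟨h1, h2⟩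
    · exact mul_neg_of_neg_of_pos (transfer_neg hf hg ha hc hy hay h2)
        (transfer_pos hf hg ha hc hx hax h1)
    · exact mul_neg_of_pos_of_neg (transfer_pos hf hg ha hc hy hay h2)
        (transfer_neg hf hg ha hc hx hax h1)
  have t3 := transfer_mem hf hg ha hc m3 n3
  have t0 := transfer_mem hf hg ha hc m0 n0
  exact hN c a hc ha _ _ _ _ t3.1 (transfer_strictAnti hf hg ha hc m2.1 h23 h3 n3)
    (transfer_strictAnti hf hg ha hc m1.1 h12 m2.2 n2)
    (transfer_strictAnti hf hg ha hc m0.1 h01 m1.2 n1) t0.2.1 t0.2.2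
    ⟨hprod _ _ m2 n2 m3 n3 hC, hprod _ _ m1 n1 m2 n2 hB, hprod _ _ m0 n0 m1 n1 hA⟩

/-- A form of the mean value theorem for `x ↦ T f (a x) - b T g x`, with a sign parameter `s`. -/
lemma exists_slope_sign (hf : f ∈ classD) (hg : g ∈ classD) (ha : 0 < a) {u v s : ℝ} (hu : 0 ≤ u)
    (huv : u < v) (hv : v ≤ 1) (hav : a * v ≤ 1)
    (h : s * (T f (a * u) - b * T g u) < s * (T f (a * v) - b * T g v)) :
    ∃ ξ ∈ Ioo u v,
      0 < s * (b / area g * pseudoInv g ξ - a / area f * pseudoInv f (a * ξ)) := by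
  have hmaps : MapsTo (fun x => a * x) (Icc u v) I01 := fun x hx =>
    ⟨mul_nonneg ha.le (hu.trans hx.1), (mul_le_mul_of_nonneg_left hx.2 ha.le).trans hav⟩
  have hcont : ContinuousOn (fun x => s * (T f (a * x) - b * T g x)) (Icc u v) := by
    refine continuousOn_const.mul (ContinuousOn.sub ?_ (continuousOn_const.mul ?_))
    · exact (T_continuousOn hf.1).comp (continuousOn_const.mul continuousOn_id) hmaps
    · exact (T_continuousOn hg.1).mono (Icc_subset_Icc hu hv)
  obtain ⟨ξ, hξ, hs⟩ := exists_hasDerivAt_eq_slope (fun x => s * (T f (a * x) - b * T g x))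
    (fun ξ => s * (b / area g * pseudoInv g ξ - a / area f * pseudoInv f (a * ξ))) huv hcont
    (fun x hx => by
      have h1 : a * x ∈ Ioo (0 : ℝ) 1 := ⟨mul_pos ha (hu.trans_lt hx.1),
        (mul_lt_mul_of_pos_left hx.2 ha).trans_le hav⟩
      have hfa := (hasDerivAt_T hf h1).comp x ((hasDerivAt_id x).const_mul a)
      have hgb := (hasDerivAt_T hg ⟨hu.trans_lt hx.1, hx.2.trans_le hv⟩).const_mul b
      refine ((hfa.sub hgb).const_mul s).congr_deriv ?_
      ring)
  refine ⟨ξ, hξ, ?_⟩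
  rw [hs]
  exact div_pos (by linarith) (by linarith)

/-- `T` does not increase the number of alternations. The mean value theorem loses one alternation,
but the behaviour at the right end point of `[0, min {1, 1/a}]` supplies it again. -/
lemma AtMostTwoAlternations.T (hN : AtMostTwoAlternations f g) (hf : f ∈ classD)
    (hg : g ∈ classD) : AtMostTwoAlternations (T f) (T g) := by
  intro a b ha hb x₀ x₁ x₂ x₃ h0 h01 h12 h23 h3 ha3 ⟨hA, hB, hC⟩
  have hAf := classC.area_pos hf.1
  have hAg := classC.area_pos hg.1
  set Δ : ℝ → ℝ := fun x => Stribola.T f (a * x) - b * Stribola.T g x with hΔ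
  set D : ℝ → ℝ := fun ξ => b / area g * Stribola.pseudoInv g ξ -
    a / area f * Stribola.pseudoInv f (a * ξ) with hD
  -- `s` is the sign of `Δ x₀`, up to a positive factor
  obtain ⟨s, s0, s1, s2, s3⟩ : ∃ s, 0 < s * Δ x₀ ∧ s * Δ x₁ < 0 ∧ 0 < s * Δ x₂ ∧
      s * Δ x₃ < 0 := by
    change Δ x₀ * Δ x₁ < 0 at hA
    change Δ x₁ * Δ x₂ < 0 at hB
    change Δ x₂ * Δ x₃ < 0 at hC
    rcases mul_neg_iff.1 hA with ⟨p0, p1⟩ | ⟨p0, p1⟩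
    · have p2 := pos_of_mul_neg_right hB p1.le
      have p3 := neg_of_mul_neg_right hC p2.le
      exact ⟨1, by simpa, by simpa, by simpa, by simpa⟩
    · have p2 := neg_of_mul_neg_right hB p1.le
      have p3 := pos_of_mul_neg_right hC p2.le
      exact ⟨-1, by simpa, by simpa, by simpa, by simpa⟩
  have ha2 : a * x₂ ≤ 1 := (mul_le_mul_of_nonneg_left h23.le ha.le).trans ha3
  have ha1 : a * x₁ ≤ 1 := (mul_le_mul_of_nonneg_left h12.le ha.le).trans ha2
  obtain ⟨ξ₀, ⟨i0, j0⟩, d0⟩ := exists_slope_sign (b := b) (s := -s) hf hg ha h0 h01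
    (by linarith) ha1 (by simp only [hΔ] at s0 s1; linarith)
  obtain ⟨ξ₁, ⟨i1, j1⟩, d1⟩ := exists_slope_sign (b := b) (s := s) hf hg ha (by linarith) h12
    (by linarith) ha2 (by simp only [hΔ] at s1 s2; linarith)
  obtain ⟨ξ₂, ⟨i2, j2⟩, d2⟩ := exists_slope_sign (b := b) (s := -s) hf hg ha (by linarith) h23
    h3 ha3 (by simp only [hΔ] at s2 s3; linarith)
  change 0 < -s * D ξ₀ at d0
  change 0 < s * D ξ₁ at d1
  change 0 < -s * D ξ₂ at d2
  obtain ⟨ξ₃, k3, l3, m3, d3⟩ : ∃ ξ₃, x₃ ≤ ξ₃ ∧ ξ₃ ≤ 1 ∧ a * ξ₃ ≤ 1 ∧ 0 < s * D ξ₃ := by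
    rcases lt_trichotomy a 1 with h | h | h
    · -- here `Δ 1 = T f a > 0` and `D 1 < 0`
      have haI : a ∈ I01 := ⟨ha.le, h.le⟩
      have hΔ1 : 0 < Δ 1 := by
        simp only [hΔ, mul_one, T_one, mul_zero, sub_zero]
        exact classD.pos (T_mem_classD hf.1) haI h
      have hD1 : D 1 < 0 := by
        simp only [hD, mul_one, pseudoInv_one hg, mul_zero, zero_sub]
        exact neg_neg_of_pos (mul_pos (div_pos ha hAf) (pseudoInv_pos hf.1 haI h))
      rcases lt_or_ge 0 s with hs | hs
      · have hx3 : x₃ < 1 := by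
          refine lt_of_le_of_ne h3 fun he => ?_
          rw [he] at s3
          exact absurd (mul_pos hs hΔ1) (not_lt.2 s3.le)
        obtain ⟨ξ, hξ, hd⟩ := exists_slope_sign (b := b) (s := s) hf hg ha (by linarith) hx3 le_rfl
          (by linarith) (s3.trans (mul_pos hs hΔ1))
        exact ⟨ξ, hξ.1.le, hξ.2.le, by nlinarith [hξ.2], hd⟩
      · have hs' : s < 0 := lt_of_le_of_ne hs fun he => by simp [he] at s0
        exact ⟨1, h3, le_rfl, by linarith, mul_pos_of_neg_of_neg hs' hD1⟩
    · -- here `Δ 1 = 0`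
      subst h
      have hΔ1 : Δ 1 = 0 := by simp [hΔ, T_one]
      have hx3 : x₃ < 1 := by
        refine lt_of_le_of_ne h3 fun he => ?_
        rw [he, hΔ1, mul_zero] at s3
        exact lt_irrefl _ s3
      obtain ⟨ξ, hξ, hd⟩ := exists_slope_sign (b := b) (s := s) hf hg ha (by linarith) hx3 le_rfl
        (by linarith) (by
          change s * Δ x₃ < s * Δ 1
          rwa [hΔ1, mul_zero])
      exact ⟨ξ, hξ.1.le, hξ.2.le, by linarith [hξ.2], hd⟩
    · -- here `Δ (1/a) = - b T g (1/a) < 0` and `D (1/a) > 0`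
      have haa : a * a⁻¹ = 1 := mul_inv_cancel₀ ha.ne'
      have hinv : a⁻¹ < 1 := inv_lt_one_of_one_lt₀ h
      have haI : a⁻¹ ∈ I01 := ⟨(inv_pos.2 ha).le, hinv.le⟩
      have hΔ1 : Δ a⁻¹ < 0 := by
        simp only [hΔ, haa, T_one, zero_sub]
        exact neg_neg_of_pos (mul_pos hb (classD.pos (T_mem_classD hg.1) haI hinv))
      have hD1 : 0 < D a⁻¹ := by
        simp only [hD, haa, pseudoInv_one hf, mul_zero, sub_zero]
        exact mul_pos (div_pos hb hAg) (pseudoInv_pos hg.1 haI hinv)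
      have hx3' : x₃ ≤ a⁻¹ := by
        rw [← one_div, le_div_iff₀ ha]; linarith
      rcases lt_or_ge 0 s with hs | hs
      · exact ⟨a⁻¹, hx3', hinv.le, haa.le, mul_pos hs hD1⟩
      · have hs' : s < 0 := lt_of_le_of_ne hs fun he => by simp [he] at s0
        have hp := mul_pos_of_neg_of_neg hs' hΔ1
        have hx3 : x₃ < a⁻¹ := by
          refine lt_of_le_of_ne hx3' fun he => ?_
          rw [he] at s3
          exact absurd hp (not_lt.2 s3.le)
        obtain ⟨ξ, hξ, hd⟩ := exists_slope_sign (b := b) (s := s) hf hg ha (by linarith) hx3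
          hinv.le haa.le (s3.trans hp)
        exact ⟨ξ, hξ.1.le, by linarith [hξ.2],
          (mul_le_mul_of_nonneg_left hξ.2.le ha.le).trans haa.le, hd⟩
  -- the signs of `D` are those of `f* (a ξ) - c g* ξ`, reversed
  have hE : ∀ ξ, Stribola.pseudoInv f (a * ξ) - b * area f / (a * area g) *
      Stribola.pseudoInv g ξ = -(area f / a) * D ξ := by
    intro ξ
    simp only [hD]
    field_simp
    ring
  have hsq : 0 < (area f / a) ^ 2 := by positivity
  have hprod : ∀ p q : ℝ, D p * D q < 0 →
      (-(area f / a) * D p) * (-(area f / a) * D q) < 0 := by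
    intro p q h
    calc (-(area f / a) * D p) * (-(area f / a) * D q) = (area f / a) ^ 2 * (D p * D q) := by ring
      _ < 0 := mul_neg_of_pos_of_neg hsq h
  have hneg : ∀ p q : ℝ, 0 < s * p → 0 < -s * q → p * q < 0 := by
    intro p q h1 h2
    by_contra! h
    have : 0 < (s * p) * (-s * q) := mul_pos h1 h2
    nlinarith [mul_nonneg (sq_nonneg s) h]
  refine hN.pseudoInv hf hg a (b * area f / (a * area g)) ha (by positivity) ξ₀ ξ₁ ξ₂ ξ₃
    (by linarith) (by linarith) (by linarith) (by linarith) l3 m3 ?_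
  simp only [hE]
  refine ⟨hprod _ _ ?_, hprod _ _ ?_, hprod _ _ ?_⟩
  · rw [mul_comm]; exact hneg _ _ d1 d0
  · exact hneg _ _ d1 d2
  · rw [mul_comm]; exact hneg _ _ d3 d2

end Alternation

/-! ### `T` preserves the order -/

section Order

variable {f g : ℝ → ℝ}

lemma area_lt_area (hf : f ∈ classD) (hg : g ∈ classD) (hle : ∀ x ∈ I01, g x ≤ f x)
    (hlt : ∃ x ∈ I01, g x < f x) : area g < area f :=
  intervalIntegral.integral_lt_integral_of_continuousOn_of_le_of_exists_lt zero_lt_one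
    (classC.cont hg.1) (classC.cont hf.1) (fun x hx => hle x ⟨hx.1.le, hx.2⟩) hlt

lemma exists_T_lt_T_near_zero (hf : f ∈ classD) (hg : g ∈ classD) (h : area g < area f)
    {r : ℝ} (hr : 0 < r) : ∃ δ, 0 < δ ∧ δ < r ∧ δ < 1 ∧ T g δ < T f δ := by
  have hd : HasDerivWithinAt (fun x => T f x - T g x) ((area g)⁻¹ - (area f)⁻¹) (Ioi 0) 0 := by
    have hI : I01 ∈ 𝓝[>] (0 : ℝ) := Icc_mem_nhdsGT zero_lt_one
    have h1 := (hasDerivWithinAt_T hf zero_mem).mono_of_mem_nhdsWithin hI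
    have h2 := (hasDerivWithinAt_T hg zero_mem).mono_of_mem_nhdsWithin hI
    refine (h1.fun_sub h2).congr_deriv ?_
    rw [pseudoInv_zero hf.1, pseudoInv_zero hg.1]
    ring
  have hpos : 0 < (area g)⁻¹ - (area f)⁻¹ :=
    sub_pos.2 (inv_strictAnti₀ (classC.area_pos hg.1) h)
  rw [hasDerivWithinAt_iff_tendsto_slope' self_notMem_Ioi] at hd
  have hev := (hd.eventually (lt_mem_nhds hpos)).and
    (Ioo_mem_nhdsGT (lt_min hr zero_lt_one))
  obtain ⟨δ, h1, h2, h3⟩ := hev.exists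
  refine ⟨δ, h2, h3.trans_le (min_le_left _ _), h3.trans_le (min_le_right _ _), ?_⟩
  rw [slope_def_field, T_zero hf.1, T_zero hg.1, sub_self, sub_zero, sub_zero] at h1
  exact sub_pos.1 ((div_pos_iff_of_pos_right h2).1 h1)

/-- If `T f < T g` somewhere, then `f* - c g*` with `c = area f / area g > 1` has signs `-, +, -`,
hence so does `z ↦ f (c z) - g z`; lowering the coefficient `1` of `g` slightly creates a fourth
sign at `z = 0`. -/
lemma T_le_T (hN : AtMostTwoAlternations f g) (hf : f ∈ classD) (hg : g ∈ classD)
    (hlt : area g < area f) : ∀ x ∈ I01, T g x ≤ T f x := by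
  intro x hx
  by_contra! hx'
  have hAf := classC.area_pos hf.1
  have hAg := classC.area_pos hg.1
  have hx0 : 0 < x := by
    refine lt_of_le_of_ne hx.1 fun he => ?_
    rw [← he, T_zero hf.1, T_zero hg.1] at hx'
    exact lt_irrefl _ hx'
  have hx1 : x < 1 := by
    refine lt_of_le_of_ne hx.2 fun he => ?_
    rw [he, T_one, T_one] at hx'
    exact lt_irrefl _ hx'
  obtain ⟨δ, hδ0, hδx, hδ1, hδ⟩ := exists_T_lt_T_near_zero hf hg hlt hx0
  obtain ⟨ξ₀, i0, d0⟩ := exists_slope_sign (b := 1) (s := 1) hf hg one_pos le_rfl hδ0 hδ1.le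
    (by linarith) (by simp only [mul_zero, T_zero hf.1, T_zero hg.1, one_mul]; linarith)
  obtain ⟨ξ₁, i1, d1⟩ := exists_slope_sign (b := 1) (s := -1) hf hg one_pos hδ0.le hδx hx.2
    (by linarith) (by simp only [one_mul]; linarith)
  obtain ⟨ξ₂, i2, d2⟩ := exists_slope_sign (b := 1) (s := 1) hf hg one_pos hx.1 hx1 le_rfl
    (by linarith) (by simp only [mul_one, T_one, one_mul]; linarith)
  set c := area f / area g with hc
  have hc1 : 1 < c := (one_lt_div hAg).2 hlt
  have hc0 : 0 < c := by linarith
  have hE : ∀ ξ, pseudoInv f (1 * ξ) - c * pseudoInv g ξ =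
      -area f * (1 * (1 / area g * pseudoInv g ξ - 1 / area f * pseudoInv f (1 * ξ))) := by
    intro ξ
    rw [hc]
    field_simp
    ring
  have m0 : ξ₀ ∈ I01 := ⟨i0.1.le, by linarith [i0.2]⟩
  have m1 : ξ₁ ∈ I01 := ⟨by linarith [i1.1], by linarith [i1.2]⟩
  have m2 : ξ₂ ∈ I01 := ⟨by linarith [i2.1], i2.2.le⟩
  have n0 : 1 * ξ₀ ≤ 1 := by rw [one_mul]; exact m0.2
  have n1 : 1 * ξ₁ ≤ 1 := by rw [one_mul]; exact m1.2
  have n2 : 1 * ξ₂ ≤ 1 := by rw [one_mul]; exact m2.2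
  have e0 := transfer_neg hf hg one_pos hc0 m0 n0
    (by rw [hE]; exact mul_neg_of_neg_of_pos (by linarith) d0)
  have e1 := transfer_pos hf hg one_pos hc0 m1 n1
    (by rw [hE]; exact mul_pos_of_neg_of_neg (by linarith) (by linarith))
  have e2 := transfer_neg hf hg one_pos hc0 m2 n2
    (by rw [hE]; exact mul_neg_of_neg_of_pos (by linarith) d2)
  have z21 := transfer_strictAnti hf hg one_pos hc0 m1.1 (i1.2.trans i2.1) m2.2 n2
  have z10 := transfer_strictAnti hf hg one_pos hc0 m0.1 (i0.2.trans i1.1) m1.2 n1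
  have t0 := transfer_mem hf hg one_pos hc0 m0 n0
  have t1 := transfer_mem hf hg one_pos hc0 m1 n1
  have t2 : 0 < transfer f g 1 c ξ₂ := by
    refine lt_min (pseudoInv_pos hg.1 m2 i2.2) (div_pos ?_ hc0)
    rw [one_mul]
    exact pseudoInv_pos hf.1 m2 i2.2
  set z₀ := transfer f g 1 c ξ₀
  set z₁ := transfer f g 1 c ξ₁
  set z₂ := transfer f g 1 c ξ₂
  have hnear : ∀ z, f (c * z) - 1 * g z < 0 → ∀ᶠ b in 𝓝[<] (1 : ℝ), f (c * z) - b * g z < 0 := by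
    intro z hz
    have hcont : Continuous fun b : ℝ => f (c * z) - b * g z := by fun_prop
    exact (hcont.tendsto 1).mono_left nhdsWithin_le_nhds |>.eventually (gt_mem_nhds hz)
  obtain ⟨b, ⟨hb0, hb2⟩, hbI⟩ := (((hnear z₀ e0).and (hnear z₂ e2)).and
    (Ioo_mem_nhdsLT zero_lt_one)).exists
  have e1' : 0 < f (c * z₁) - b * g z₁ := by
    have : b * g z₁ ≤ 1 * g z₁ :=
      mul_le_mul_of_nonneg_right hbI.2.le (classC.nonneg hg.1 ⟨t1.1, t1.2.1⟩)
    linarith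
  have e3 : 0 < f (c * 0) - b * g 0 := by
    rw [mul_zero, classC.zero hf.1, classC.zero hg.1]
    linarith [hbI.2]
  exact hN c b hc0 hbI.1 0 z₂ z₁ z₀ le_rfl t2 z21 z10 t0.2.1 t0.2.2
    ⟨mul_neg_of_pos_of_neg e3 hb2, mul_neg_of_neg_of_pos hb2 e1', mul_neg_of_pos_of_neg e1' hb0⟩

end Order

/-! ### The crossing number -/

section CrossingNumber

/-- Three successive sign switches yield four alternating signs. -/
lemma exists_alternation_of_switches {A B : ℝ} {Δ : ℝ → ℝ} {p q r : ℝ × ℝ}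
    (hp : p ∈ signSwitches A B Δ) (hq : q ∈ signSwitches A B Δ) (hr : r ∈ signSwitches A B Δ)
    (hpq : p.2 < q.1) (hqr : q.2 < r.1) :
    ∃ x₀ x₁ x₂ x₃, A ≤ x₀ ∧ x₀ < x₁ ∧ x₁ < x₂ ∧ x₂ < x₃ ∧ x₃ ≤ B ∧
      Δ x₀ * Δ x₁ < 0 ∧ Δ x₁ * Δ x₂ < 0 ∧ Δ x₂ * Δ x₃ < 0 := by
  obtain ⟨p1, p2, p3, -, δ, dp0, dp1, dp⟩ := hp
  obtain ⟨q1, q2, q3, -, ε, dq0, dq1, dq⟩ := hq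
  obtain ⟨r1, r2, r3, -, η, dr0, dr1, dr⟩ := hr
  obtain ⟨τ, hτ0, h1, h2, h3, h4, h5⟩ : ∃ τ, 0 < τ ∧ τ ≤ δ ∧ τ ≤ ε ∧ τ ≤ η ∧
      p.2 + τ < q.1 - τ ∧ q.2 + τ < r.1 - τ := by
    refine ⟨min (min δ ε) (min η (min ((q.1 - p.2) / 3) ((r.1 - q.2) / 3))), ?_, ?_⟩
    · refine lt_min (lt_min dp0 dq0) (lt_min dr0 (lt_min ?_ ?_)) <;> linarith
    · set τ := min (min δ ε) (min η (min ((q.1 - p.2) / 3) ((r.1 - q.2) / 3)))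
      have t1 : τ ≤ (q.1 - p.2) / 3 :=
        (min_le_right _ _).trans ((min_le_right _ _).trans (min_le_left _ _))
      have t2 : τ ≤ (r.1 - q.2) / 3 :=
        (min_le_right _ _).trans ((min_le_right _ _).trans (min_le_right _ _))
      exact ⟨(min_le_left _ _).trans (min_le_left _ _), (min_le_left _ _).trans (min_le_right _ _),
        (min_le_right _ _).trans (min_le_left _ _), by linarith, by linarith⟩
  have sp := dp τ ⟨hτ0, h1⟩
  have sq := dq τ ⟨hτ0, h2⟩
  have sr := dr τ ⟨hτ0, h3⟩
  have bA : A ≤ p.1 - τ := by linarith [min_le_left (p.1 - A) (B - p.2)]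
  have bB : r.2 + τ ≤ B := by linarith [min_le_right (r.1 - A) (B - r.2)]
  have same : ∀ {u v w : ℝ}, u * v < 0 → w ≠ 0 → ¬ u * w < 0 → w * v < 0 := by
    intro u v w huv hw huw
    rcases mul_neg_iff.1 huv with ⟨a, b⟩ | ⟨a, b⟩
    · exact mul_neg_of_pos_of_neg (lt_of_le_of_ne (le_of_mul_le_mul_left (by linarith) a)
        (Ne.symm hw)) b
    · refine mul_neg_of_neg_of_pos (lt_of_le_of_ne ?_ hw) b
      by_contra! h
      exact huw (mul_neg_of_neg_of_pos a h)
  have nz : ∀ {u v : ℝ}, u * v < 0 → u ≠ 0 ∧ v ≠ 0 := fun h =>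
    ⟨fun h0 => by simp [h0] at h, fun h0 => by simp [h0] at h⟩
  by_cases h : Δ (p.2 + τ) * Δ (q.1 - τ) < 0
  · exact ⟨p.1 - τ, p.2 + τ, q.1 - τ, q.2 + τ, bA, by linarith, by linarith, by linarith,
      by linarith, sp, h, sq⟩
  · -- `Δ` has the same sign at `p.2 + τ` and `q.1 - τ`, so the latter point can be dropped
    have s1 : Δ (p.2 + τ) * Δ (q.2 + τ) < 0 :=
      same sq (nz sp).2 (by rwa [mul_comm])
    by_cases h' : Δ (q.2 + τ) * Δ (r.1 - τ) < 0
    · exact ⟨p.1 - τ, p.2 + τ, q.2 + τ, r.1 - τ, bA, by linarith, by linarith, by linarith,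
        by linarith, sp, s1, h'⟩
    · exact ⟨p.1 - τ, p.2 + τ, q.2 + τ, r.2 + τ, bA, by linarith, by linarith, by linarith,
        by linarith, sp, s1, same sr (nz s1).2 (by rwa [mul_comm])⟩

/-- Distinct sign switches are disjoint: `Δ` vanishes on each, but takes nonzero values arbitrarily
close to either end. -/
lemma signSwitches_separated {A B : ℝ} {Δ : ℝ → ℝ} {p q : ℝ × ℝ}
    (hp : p ∈ signSwitches A B Δ) (hq : q ∈ signSwitches A B Δ) (hne : p ≠ q) :
    p.2 < q.1 ∨ q.2 < p.1 := by
  by_contra! hcon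
  obtain ⟨h1, h2⟩ := hcon
  have nz : ∀ {p : ℝ × ℝ}, p ∈ signSwitches A B Δ → ∀ ρ, 0 < ρ → ∃ τ, 0 < τ ∧ τ ≤ ρ ∧
      Δ (p.1 - τ) ≠ 0 ∧ Δ (p.2 + τ) ≠ 0 := by
    intro p hp ρ hρ
    obtain ⟨-, -, -, -, δ, h0, -, hδ⟩ := hp
    have := hδ (min δ ρ) ⟨lt_min h0 hρ, min_le_left _ _⟩
    exact ⟨min δ ρ, lt_min h0 hρ, min_le_right _ _, fun h => by simp [h] at this,
      fun h => by simp [h] at this⟩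
  have hfst : ∀ {p q : ℝ × ℝ}, p ∈ signSwitches A B Δ → q ∈ signSwitches A B Δ → p.1 ≤ q.2 →
      p.1 ≤ q.1 := by
    intro p q hp hq h
    by_contra! hlt
    obtain ⟨τ, t0, t1, t2, -⟩ := nz hp (p.1 - q.1) (by linarith)
    exact t2 (hq.2.2.2.1 _ ⟨by linarith, by linarith⟩)
  have hsnd : ∀ {p q : ℝ × ℝ}, p ∈ signSwitches A B Δ → q ∈ signSwitches A B Δ → q.1 ≤ p.2 →
      q.2 ≤ p.2 := by
    intro p q hp hq h
    by_contra! hlt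
    obtain ⟨τ, t0, t1, -, t2⟩ := nz hp (q.2 - p.2) (by linarith)
    exact t2 (hq.2.2.2.1 _ ⟨by linarith, by linarith⟩)
  exact hne (Prod.ext (le_antisymm (hfst hp hq h2) (hfst hq hp h1))
    (le_antisymm (hsnd hq hp h2) (hsnd hp hq h1)))

lemma numSwitches_le_two {A B : ℝ} {Δ : ℝ → ℝ}
    (h : ∀ x₀ x₁ x₂ x₃, A ≤ x₀ → x₀ < x₁ → x₁ < x₂ → x₂ < x₃ → x₃ ≤ B →
      ¬ (Δ x₀ * Δ x₁ < 0 ∧ Δ x₁ * Δ x₂ < 0 ∧ Δ x₂ * Δ x₃ < 0)) :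
    numSwitches A B Δ ≤ 2 := by
  have key : ∀ {p q r : ℝ × ℝ}, p ∈ signSwitches A B Δ → q ∈ signSwitches A B Δ →
      r ∈ signSwitches A B Δ → p.2 < q.1 → q.2 < r.1 → False := by
    intro p q r hp hq hr h1 h2
    obtain ⟨x₀, x₁, x₂, x₃, a0, a1, a2, a3, a4, a5⟩ := exists_alternation_of_switches hp hq hr h1 h2
    exact h x₀ x₁ x₂ x₃ a0 a1 a2 a3 a4 a5
  unfold numSwitches
  by_contra! hgt
  have h3 : (3 : ℕ∞) ≤ (signSwitches A B Δ).encard := Order.add_one_le_of_lt hgt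
  obtain ⟨t, ht, ht3⟩ := Set.exists_subset_encard_eq h3
  obtain ⟨p, q, r, hpq, hpr, hqr, rfl⟩ := Set.encard_eq_three.1 ht3
  have hp : p ∈ signSwitches A B Δ := ht (by simp)
  have hq : q ∈ signSwitches A B Δ := ht (by simp)
  have hr : r ∈ signSwitches A B Δ := ht (by simp)
  have lp := hp.2.1
  have lq := hq.2.1
  have lr := hr.2.1
  rcases signSwitches_separated hp hq hpq with a | a <;>
    rcases signSwitches_separated hp hr hpr with b | b <;>
    rcases signSwitches_separated hq hr hqr with c | c
  · exact key hp hq hr a c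
  · exact key hp hr hq b c
  · linarith
  · exact key hr hp hq b a
  · exact key hq hp hr a b
  · linarith
  · exact key hq hr hp c b
  · exact key hr hq hp c a

/-- A function that passes from negative to positive values on `[l, m]`, such that nonnegative
values are only followed by nonnegative ones and positive values only by positive ones, has a sign
switch between `l` and `m`. -/
lemma exists_passage {Δ : ℝ → ℝ} {l m : ℝ} (hlm : l ≤ m) (hc : ContinuousOn Δ (Icc l m))
    (hl : Δ l < 0) (hm : 0 < Δ m)
    (hnn : ∀ u ∈ Icc l m, ∀ v ∈ Icc l m, u ≤ v → 0 ≤ Δ u → 0 ≤ Δ v)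
    (hpos : ∀ u ∈ Icc l m, ∀ v ∈ Icc l m, u ≤ v → 0 < Δ u → 0 < Δ v) :
    ∃ c d, l < c ∧ c ≤ d ∧ d < m ∧ (∀ x ∈ Ico l c, Δ x < 0) ∧ (∀ x ∈ Icc c d, Δ x = 0) ∧
      ∀ x ∈ Ioc d m, 0 < Δ x := by
  set P : Set ℝ := Icc l m ∩ Δ ⁻¹' Ici 0
  set N : Set ℝ := Icc l m ∩ Δ ⁻¹' Iic 0
  have hPcl : IsClosed P := hc.preimage_isClosed_of_isClosed isClosed_Icc isClosed_Ici
  have hNcl : IsClosed N := hc.preimage_isClosed_of_isClosed isClosed_Icc isClosed_Iic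
  have hPb : BddBelow P := ⟨l, fun x hx => hx.1.1⟩
  have hNb : BddAbove N := ⟨m, fun x hx => hx.1.2⟩
  have hcP : sInf P ∈ P := hPcl.csInf_mem ⟨m, ⟨hlm, le_rfl⟩, hm.le⟩ hPb
  have hdN : sSup N ∈ N := hNcl.csSup_mem ⟨l, ⟨le_rfl, hlm⟩, hl.le⟩ hNb
  set c := sInf P
  set d := sSup N
  have hbelow : ∀ x ∈ Ico l c, Δ x < 0 := by
    intro x hx
    by_contra! h
    exact absurd (csInf_le hPb (⟨⟨hx.1, hx.2.le.trans hcP.1.2⟩, h⟩ : x ∈ P)) (not_le.2 hx.2)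
  have habove : ∀ x ∈ Ioc d m, 0 < Δ x := by
    intro x hx
    by_contra! h
    exact absurd (le_csSup hNb (⟨⟨hdN.1.1.trans hx.1.le, hx.2⟩, h⟩ : x ∈ N)) (not_le.2 hx.1)
  refine ⟨c, d, ?_, ?_, ?_, hbelow, ?_, habove⟩
  · exact lt_of_le_of_ne hcP.1.1 fun h => absurd hcP.2 (by rw [← h]; exact not_le.2 hl)
  · by_contra! h
    have h1 := hbelow ((c + d) / 2) ⟨by linarith [hdN.1.1], by linarith⟩
    have h2 := habove ((c + d) / 2) ⟨by linarith, by linarith [hcP.1.2]⟩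
    linarith
  · exact lt_of_le_of_ne hdN.1.2 fun h => absurd hdN.2 (by rw [h]; exact not_le.2 hm)
  · intro x hx
    have hxI : x ∈ Icc l m := ⟨hcP.1.1.trans hx.1, hx.2.trans hdN.1.2⟩
    refine le_antisymm ?_ (hnn c hcP.1 x hxI hx.1 hcP.2)
    by_contra! h
    exact absurd (hpos x hxI d hdN.1 hx.2 h) (not_lt.2 hdN.2)

lemma mem_signSwitches_of_passage {Δ : ℝ → ℝ} {A B l c d m : ℝ} (hA : A ≤ l) (hB : m ≤ B)
    (hlc : l < c) (hcd : c ≤ d) (hdm : d < m) (hz : ∀ x ∈ Icc c d, Δ x = 0)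
    (hprod : ∀ x ∈ Ico l c, ∀ y ∈ Ioc d m, Δ x * Δ y < 0) : (c, d) ∈ signSwitches A B Δ := by
  refine ⟨by linarith, hcd, by simp only; linarith, hz, min (c - l) (m - d),
    lt_min (by linarith) (by linarith), min_le_min (by simp only; linarith)
    (by simp only; linarith), fun x hx => ?_⟩
  have h1 := hx.2.trans (min_le_left _ _)
  have h2 := hx.2.trans (min_le_right _ _)
  exact hprod _ ⟨by linarith, by linarith [hx.1]⟩ _ ⟨by linarith [hx.1], by linarith⟩

variable {f g : ℝ → ℝ}

/-- For `a, b > 1` close to `1`, the function `x ↦ f (a x) - b g x` is negative at `0` and at `1/a`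
and positive in between. The quotient `φ x = f (a x) / g x` must increase above the level `1` up to
its maximum and decrease afterwards, since otherwise some `φ - β` would alternate too often;
hence both changes of sign are clean. -/
lemma exists_two_switches (hN : AtMostTwoAlternations f g) (hf : f ∈ classD) (hg : g ∈ classD)
    (hlt : ∃ x ∈ I01, g x < f x) :
    ∃ a b : ℝ, 0 < a ∧ 0 < b ∧
      2 ≤ numSwitches 0 (min 1 (1 / a)) (fun x => f (a * x) - b * g x) := by
  obtain ⟨y, hy, hgf⟩ := hlt
  have hy0 : 0 < y := by
    refine lt_of_le_of_ne hy.1 fun he => ?_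
    rw [← he, classC.zero hf.1, classC.zero hg.1] at hgf
    exact lt_irrefl _ hgf
  have hy1 : y < 1 := by
    refine lt_of_le_of_ne hy.2 fun he => ?_
    rw [he, classC.one hf.1, classC.one hg.1] at hgf
    exact lt_irrefl _ hgf
  have hgy : 0 < g y := classD.pos hg hy hy1
  obtain ⟨a, ha1, hay, hga⟩ : ∃ a : ℝ, 1 < a ∧ a * y < 1 ∧ g y < f (a * y) := by
    have hfc : ContinuousAt f (1 * y) := by
      rw [one_mul]
      exact (classC.cont hf.1).continuousAt (Icc_mem_nhds hy0 hy1)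
    have hcomp : Tendsto (fun a : ℝ => f (a * y)) (𝓝 1) (𝓝 (f (1 * y))) :=
      hfc.tendsto.comp ((continuous_id.mul continuous_const).tendsto (1 : ℝ))
    have hcomp' : Tendsto (fun a : ℝ => a * y) (𝓝 1) (𝓝 (1 * y)) :=
      (continuous_id.mul continuous_const).tendsto (1 : ℝ)
    rw [one_mul] at hcomp hcomp'
    have hev := ((hcomp.eventually (lt_mem_nhds hgf)).and
      (hcomp'.eventually (gt_mem_nhds hy1))).filter_mono (nhdsWithin_le_nhds (s := Ioi 1))
    obtain ⟨a, ⟨h1, h2⟩, h3⟩ := (hev.and self_mem_nhdsWithin).exists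
    exact ⟨a, h3, h2, h1⟩
  have ha0 : 0 < a := by linarith
  have haa : a * a⁻¹ = 1 := mul_inv_cancel₀ ha0.ne'
  have hinv : a⁻¹ < 1 := inv_lt_one_of_one_lt₀ ha1
  have hinv0 : 0 < a⁻¹ := inv_pos.2 ha0
  have hya : y < a⁻¹ := by
    rw [← one_div, lt_div_iff₀ ha0]; linarith
  obtain ⟨b, hb1, hb⟩ : ∃ b : ℝ, 1 < b ∧ b * g y < f (a * y) := by
    obtain ⟨b, h1, h2⟩ := exists_between ((one_lt_div hgy).2 hga)
    exact ⟨b, h1, (lt_div_iff₀ hgy).1 h2⟩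
  have hsub : ∀ x ∈ Icc 0 a⁻¹, x ∈ I01 ∧ a * x ≤ 1 := fun x hx =>
    ⟨⟨hx.1, hx.2.trans hinv.le⟩, (mul_le_mul_of_nonneg_left hx.2 ha0.le).trans haa.le⟩
  have hgpos : ∀ x ∈ Icc 0 a⁻¹, 0 < g x := fun x hx =>
    classD.pos hg (hsub x hx).1 (hx.2.trans_lt hinv)
  set φ : ℝ → ℝ := fun x => f (a * x) / g x with hφ
  have hfa : ContinuousOn (fun x => f (a * x)) (Icc 0 a⁻¹) :=
    (classC.cont hf.1).comp (continuousOn_const.mul continuousOn_id)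
      fun x hx => ⟨mul_nonneg ha0.le hx.1, (hsub x hx).2⟩
  have hga' : ContinuousOn g (Icc 0 a⁻¹) := (classC.cont hg.1).mono fun x hx => (hsub x hx).1
  have hφc : ContinuousOn φ (Icc 0 a⁻¹) := hfa.div hga' fun x hx => (hgpos x hx).ne'
  -- levels of `φ` translate into signs of `f (a x) - β g x`
  have hlow : ∀ β, ∀ x ∈ Icc 0 a⁻¹, f (a * x) - β * g x < 0 ↔ φ x < β := fun β x hx => by
    rw [sub_neg, hφ, div_lt_iff₀ (hgpos x hx)]
  have hhigh : ∀ β, ∀ x ∈ Icc 0 a⁻¹, 0 < f (a * x) - β * g x ↔ β < φ x := fun β x hx => by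
    rw [sub_pos, hφ, lt_div_iff₀ (hgpos x hx)]
  have hle : ∀ β, ∀ x ∈ Icc 0 a⁻¹, 0 ≤ f (a * x) - β * g x ↔ β ≤ φ x := fun β x hx => by
    rw [sub_nonneg, hφ, le_div_iff₀ (hgpos x hx)]
  have hle' : ∀ β, ∀ x ∈ Icc 0 a⁻¹, f (a * x) - β * g x ≤ 0 ↔ φ x ≤ β := fun β x hx => by
    rw [sub_nonpos, hφ, div_le_iff₀ (hgpos x hx)]
  have h0I : (0 : ℝ) ∈ Icc 0 a⁻¹ := ⟨le_rfl, hinv0.le⟩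
  have h1I : a⁻¹ ∈ Icc 0 a⁻¹ := ⟨hinv0.le, le_rfl⟩
  have hφ0 : φ 0 = 1 := by simp [hφ, classC.zero hf.1, classC.zero hg.1]
  have hφ1 : φ a⁻¹ = 0 := by simp [hφ, haa, classC.one hf.1]
  obtain ⟨m, hmI, hmax⟩ := isCompact_Icc.exists_isMaxOn ⟨0, h0I⟩ hφc
  have hmax' : ∀ x ∈ Icc 0 a⁻¹, φ x ≤ φ m := fun x hx => hmax hx
  have hbm : b < φ m := by
    refine lt_of_lt_of_le ?_ (hmax' y ⟨hy.1, hya.le⟩)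
    exact (hhigh b y ⟨hy.1, hya.le⟩).1 (by linarith)
  -- no level `β > 1` sees the pattern low, high, low, high, low
  have hno : ∀ β, 1 < β → ∀ u v w, u ∈ Icc 0 a⁻¹ → v ∈ Icc 0 a⁻¹ → w ∈ Icc 0 a⁻¹ → u ≤ v →
      v ≤ w → β < φ u → φ v < β → β < φ w → False := by
    intro β hβ u v w hu hv hw huv hvw h1 h2 h3
    have hu0 : 0 < u := by
      refine lt_of_le_of_ne hu.1 fun he => ?_
      rw [← he, hφ0] at h1
      linarith
    have huv' : u < v := lt_of_le_of_ne huv fun he => by rw [he] at h1; linarith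
    have hvw' : v < w := lt_of_le_of_ne hvw fun he => by rw [he] at h2; linarith
    have e0 := (hlow β 0 h0I).2 (by rw [hφ0]; exact hβ)
    have e1 := (hhigh β u hu).2 h1
    have e2 := (hlow β v hv).2 h2
    have e3 := (hhigh β w hw).2 h3
    exact hN a β ha0 (by linarith) 0 u v w le_rfl hu0 huv' hvw' (hsub w hw).1.2 (hsub w hw).2
      ⟨mul_neg_of_neg_of_pos e0 e1, mul_neg_of_pos_of_neg e1 e2, mul_neg_of_neg_of_pos e2 e3⟩
  have hleft : ∀ u v, u ∈ Icc 0 a⁻¹ → v ∈ Icc 0 a⁻¹ → u ≤ v → v ≤ m → 1 < φ u → φ u ≤ φ v := by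
    intro u v hu hv huv hvm h1
    by_contra! h
    obtain ⟨β, hβ1, hβ2⟩ := exists_between (max_lt h1 h)
    exact hno β ((le_max_left _ _).trans_lt hβ1) u v m hu hv hmI huv hvm hβ2
      ((le_max_right _ _).trans_lt hβ1) (hβ2.trans_le (hmax' u hu))
  have hright : ∀ u v, u ∈ Icc 0 a⁻¹ → v ∈ Icc 0 a⁻¹ → u ≤ v → m ≤ u → 1 < φ v → φ v ≤ φ u := by
    intro u v hu hv huv hmu h1
    by_contra! h
    obtain ⟨β, hβ1, hβ2⟩ := exists_between (max_lt h1 h)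
    exact hno β ((le_max_left _ _).trans_lt hβ1) m u v hmI hu hv hmu huv
      (hβ2.trans_le (hmax' v hv)) ((le_max_right _ _).trans_lt hβ1) hβ2
  set Δ : ℝ → ℝ := fun x => f (a * x) - b * g x with hΔ
  have hΔc : ContinuousOn Δ (Icc 0 a⁻¹) := hfa.sub (continuousOn_const.mul hga')
  have hml : ∀ x ∈ Icc 0 m, x ∈ Icc 0 a⁻¹ := fun x hx => ⟨hx.1, hx.2.trans hmI.2⟩
  have hmr : ∀ x ∈ Icc m a⁻¹, x ∈ Icc 0 a⁻¹ := fun x hx => ⟨hmI.1.trans hx.1, hx.2⟩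
  obtain ⟨c, d, k1, k2, k3, k4, k5, k6⟩ := exists_passage hmI.1 (hΔc.mono hml)
    ((hlow b 0 h0I).2 (by rw [hφ0]; exact hb1)) ((hhigh b m hmI).2 hbm)
    (fun u hu v hv huv h => (hle b v (hml v hv)).2 (by
      have := (hle b u (hml u hu)).1 h
      exact this.trans (hleft u v (hml u hu) (hml v hv) huv hv.2 (by linarith))))
    (fun u hu v hv huv h => (hhigh b v (hml v hv)).2 (by
      have := (hhigh b u (hml u hu)).1 h
      exact this.trans_le (hleft u v (hml u hu) (hml v hv) huv hv.2 (by linarith))))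
  -- to the right of `m` the same is applied to `-Δ`
  obtain ⟨c', d', l1, l2, l3, l4, l5, l6⟩ := exists_passage (Δ := fun x => -Δ x) hmI.2
    (hΔc.mono hmr).neg (neg_neg_of_pos ((hhigh b m hmI).2 hbm))
    (neg_pos.2 ((hlow b a⁻¹ h1I).2 (by rw [hφ1]; linarith)))
    (fun u hu v hv huv h => neg_nonneg.2 ((hle' b v (hmr v hv)).2 (by
      have h' := (hle' b u (hmr u hu)).1 (neg_nonneg.1 h)
      by_contra! hv'
      linarith [hright u v (hmr u hu) (hmr v hv) huv hu.1 (by linarith)])))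
    (fun u hu v hv huv h => neg_pos.2 ((hlow b v (hmr v hv)).2 (by
      have h' := (hlow b u (hmr u hu)).1 (neg_pos.1 h)
      by_contra! hv'
      linarith [hright u v (hmr u hu) (hmr v hv) huv hu.1 (by linarith)])))
  refine ⟨a, b, ha0, by linarith, ?_⟩
  have hmin : min 1 (1 / a) = a⁻¹ := by
    rw [one_div]; exact min_eq_right hinv.le
  rw [hmin]
  have s1 : (c, d) ∈ signSwitches 0 a⁻¹ Δ :=
    mem_signSwitches_of_passage le_rfl hmI.2 k1 k2 k3 k5
      fun x hx y hy => mul_neg_of_neg_of_pos (k4 x hx) (k6 y hy)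
  have s2 : (c', d') ∈ signSwitches 0 a⁻¹ Δ :=
    mem_signSwitches_of_passage hmI.1 le_rfl l1 l2 l3 (fun x hx => neg_eq_zero.1 (l5 x hx))
      fun x hx y hy => mul_neg_of_pos_of_neg (neg_neg_iff_pos.1 (l4 x hx)) (neg_pos.1 (l6 y hy))
  have hne : (c, d) ≠ (c', d') := by
    intro h
    have := congrArg Prod.fst h
    simp only at this
    linarith
  unfold numSwitches
  rw [← Set.encard_pair hne]
  exact Set.encard_le_encard (by
    rintro p (rfl | rfl)
    exacts [s1, s2])

lemma crossingNumber_eq_two (hN : AtMostTwoAlternations f g) (hf : f ∈ classD) (hg : g ∈ classD)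
    (hlt : ∃ x ∈ I01, g x < f x) : crossingNumber f g = 2 := by
  refine le_antisymm ?_ ?_
  · refine iSup_le fun a => iSup_le fun b => iSup_le fun ha => iSup_le fun hb => ?_
    refine numSwitches_le_two fun x₀ x₁ x₂ x₃ h0 h01 h12 h23 h3 => ?_
    refine hN a b ha hb x₀ x₁ x₂ x₃ h0 h01 h12 h23 (h3.trans (min_le_left _ _)) ?_
    rw [mul_comm]
    exact (le_div_iff₀ ha).1 (h3.trans (min_le_right _ _))
  · obtain ⟨a, b, ha, hb, h⟩ := exists_two_switches hN hf hg hlt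
    exact h.trans (le_iSup_of_le a (le_iSup_of_le b (le_iSup_of_le ha (le_iSup_of_le hb le_rfl))))

end CrossingNumber

/-! ### A lower bound for the areas -/

section AreaBound

variable {f : ℝ → ℝ}

lemma integral_quadratic (α β γ u v : ℝ) :
    ∫ x in u..v, (α + β * x + γ * x ^ 2) =
      α * (v - u) + β * ((v ^ 2 - u ^ 2) / 2) + γ * ((v ^ 3 - u ^ 3) / 3) := by
  rw [intervalIntegral.integral_add (Continuous.intervalIntegrable (by fun_prop) _ _)
    (Continuous.intervalIntegrable (by fun_prop) _ _),
    intervalIntegral.integral_add (Continuous.intervalIntegrable (by fun_prop) _ _)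
    (Continuous.intervalIntegrable (by fun_prop) _ _),
    intervalIntegral.integral_const_mul, intervalIntegral.integral_const_mul, integral_id,
    integral_pow, intervalIntegral.integral_const, smul_eq_mul]
  norm_num
  ring

/-- The moments of the piecewise linear function `max (1 - 5 x) (m (1 - x))`, whose two pieces
meet at `t`. -/
lemma integral_max_pow {t m : ℝ} (ht0 : 0 ≤ t) (ht1 : t < 1) (hm : m * (1 - t) = 1 - 5 * t) :
    ∫ x in (0 : ℝ)..1, max (1 - 5 * x) (m * (1 - x)) = 1 / 2 - 2 * t ∧
    ∫ x in (0 : ℝ)..1, max (1 - 5 * x) (m * (1 - x)) ^ 2 =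
      1 / 3 - 8 / 3 * t + 20 / 3 * t ^ 2 := by
  have hleft : ∀ x, x ≤ t → max (1 - 5 * x) (m * (1 - x)) = 1 - 5 * x := by
    intro x hx
    refine max_eq_left ?_
    have : (m * (1 - x)) * (1 - t) ≤ (1 - 5 * x) * (1 - t) := by
      calc (m * (1 - x)) * (1 - t) = (m * (1 - t)) * (1 - x) := by ring
        _ = (1 - 5 * t) * (1 - x) := by rw [hm]
        _ ≤ (1 - 5 * x) * (1 - t) := by linarith
    exact le_of_mul_le_mul_right this (by linarith)
  have hright : ∀ x, t ≤ x → max (1 - 5 * x) (m * (1 - x)) = m * (1 - x) := by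
    intro x hx
    refine max_eq_right ?_
    have : (1 - 5 * x) * (1 - t) ≤ (m * (1 - x)) * (1 - t) := by
      calc (1 - 5 * x) * (1 - t) ≤ (1 - 5 * t) * (1 - x) := by linarith
        _ = (m * (1 - t)) * (1 - x) := by rw [hm]
        _ = (m * (1 - x)) * (1 - t) := by ring
    exact le_of_mul_le_mul_right this (by linarith)
  have hcont : Continuous fun x : ℝ => max (1 - 5 * x) (m * (1 - x)) := by fun_prop
  have hcont2 : Continuous fun x : ℝ => max (1 - 5 * x) (m * (1 - x)) ^ 2 := by fun_prop
  constructor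
  · rw [← intervalIntegral.integral_add_adjacent_intervals (hcont.intervalIntegrable 0 t)
      (hcont.intervalIntegrable t 1)]
    have h1 : ∫ x in (0 : ℝ)..t, max (1 - 5 * x) (m * (1 - x)) =
        ∫ x in (0 : ℝ)..t, (1 + -5 * x + 0 * x ^ 2) :=
      intervalIntegral.integral_congr fun x hx => by
        rw [uIcc_of_le ht0] at hx
        simp only [hleft x hx.2]
        ring
    have h2 : ∫ x in t..1, max (1 - 5 * x) (m * (1 - x)) =
        ∫ x in t..1, (m + -m * x + 0 * x ^ 2) :=
      intervalIntegral.integral_congr fun x hx => by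
        rw [uIcc_of_le ht1.le] at hx
        simp only [hright x hx.1]
        ring
    rw [h1, h2, integral_quadratic, integral_quadratic]
    linear_combination (1 - t) / 2 * hm
  · rw [← intervalIntegral.integral_add_adjacent_intervals (hcont2.intervalIntegrable 0 t)
      (hcont2.intervalIntegrable t 1)]
    have h1 : ∫ x in (0 : ℝ)..t, max (1 - 5 * x) (m * (1 - x)) ^ 2 =
        ∫ x in (0 : ℝ)..t, (1 + -10 * x + 25 * x ^ 2) :=
      intervalIntegral.integral_congr fun x hx => by
        rw [uIcc_of_le ht0] at hx
        simp only [hleft x hx.2]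
        ring
    have h2 : ∫ x in t..1, max (1 - 5 * x) (m * (1 - x)) ^ 2 =
        ∫ x in t..1, (m ^ 2 + -2 * m ^ 2 * x + m ^ 2 * x ^ 2) :=
      intervalIntegral.integral_congr fun x hx => by
        rw [uIcc_of_le ht1.le] at hx
        simp only [hright x hx.1]
        ring
    rw [h1, h2, integral_quadratic, integral_quadratic]
    linear_combination (1 - t) / 3 * (m * (1 - t) + (1 - 5 * t)) * hm

lemma le_one_sub_of_convexOn (hf : f ∈ classC) (hconv : ConvexOn ℝ I01 f) {x : ℝ} (hx : x ∈ I01) :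
    f x ≤ 1 - x := by
  have := hconv.2 zero_mem one_mem (sub_nonneg.2 hx.2) hx.1 (by ring)
  simpa [classC.zero hf, classC.one hf] using this

/-- Among convex functions of the given area above `1 - 5 x`, the function
`F x = max (1 - 5 x) (m (1 - x))` minimizes `∫ f²`: the difference `f - F` changes sign at most
once, from `+` to `-`, while `F` decreases. The claim then reduces to the positive quadratic
`2 - 28 t + 100 t²`. -/
lemma two_fifths_area_le (hf : f ∈ classC) (hconv : ConvexOn ℝ I01 f)
    (hline : ∀ x ∈ I01, 1 - 5 * x ≤ f x) (hA : 1 / 5 ≤ area f) :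
    2 / 5 * area f ≤ ∫ x in (0 : ℝ)..1, f x ^ 2 := by
  have hAle : area f ≤ 1 / 2 := by
    have h := intervalIntegral.integral_mono_on zero_le_one (classC.intervalIntegrable hf)
      (Continuous.intervalIntegrable (by fun_prop) _ _ : IntervalIntegrable
        (fun x : ℝ => 1 + -1 * x + 0 * x ^ 2) volume 0 1)
      (fun x hx => (le_one_sub_of_convexOn hf hconv hx).trans (by linarith))
    rw [integral_quadratic] at h
    exact h.trans (by norm_num)
  -- the meeting point `t` for which `F` has the same area as `f`
  set t := 1 / 4 - area f / 2 with ht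
  have ht0 : 0 ≤ t := by linarith
  have ht1 : t ≤ 3 / 20 := by linarith
  set m := (1 - 5 * t) / (1 - t) with hm
  have hmt : m * (1 - t) = 1 - 5 * t := div_mul_cancel₀ _ (by linarith)
  have hm0 : 0 ≤ m := div_nonneg (by linarith) (by linarith)
  have hm1 : m ≤ 1 := (div_le_one (by linarith)).2 (by linarith)
  obtain ⟨hF1, hF2⟩ := integral_max_pow ht0 (by linarith) hmt
  set F : ℝ → ℝ := fun x => max (1 - 5 * x) (m * (1 - x)) with hF
  have hFcont : Continuous F := by fun_prop
  have hFanti : Antitone F := fun x y hxy =>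
    max_le_max (by linarith) (mul_le_mul_of_nonneg_left (by linarith) hm0)
  set S : Set ℝ := {x | x ∈ Ico (0 : ℝ) 1 ∧ F x ≤ f x}
  have hS0 : (0 : ℝ) ∈ S := by
    refine ⟨⟨le_rfl, zero_lt_one⟩, ?_⟩
    rw [classC.zero hf]
    exact max_le (by linarith) (by linarith)
  have hSb : BddAbove S := ⟨1, fun x hx => hx.1.2.le⟩
  set p := sSup S
  have hbefore : ∀ x ∈ I01, x < p → F x ≤ f x := by
    intro x hx hxp
    obtain ⟨s, ⟨hs, hsf⟩, hxs⟩ := exists_lt_of_lt_csSup ⟨0, hS0⟩ hxp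
    refine max_le (hline x hx) ?_
    have h1x : 0 < 1 - x := by linarith [hs.2]
    have hcomb := hconv.2 hx one_mem
      (show 0 ≤ (1 - s) / (1 - x) from div_nonneg (by linarith [hs.2]) h1x.le)
      (show 0 ≤ (s - x) / (1 - x) from div_nonneg (by linarith) h1x.le)
      (by field_simp; ring)
    have hpt : (1 - s) / (1 - x) * x + (s - x) / (1 - x) * 1 = s := by
      field_simp
      ring
    simp only [smul_eq_mul, hpt, classC.one hf, mul_zero, add_zero] at hcomb
    have h2 : m * (1 - s) ≤ (1 - s) / (1 - x) * f x :=
      (le_max_right _ _).trans (hsf.trans hcomb)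
    rw [div_mul_eq_mul_div (1 - s), le_div_iff₀ h1x] at h2
    have h1s : 0 < 1 - s := by linarith [hs.2]
    exact le_of_mul_le_mul_left (by linarith) h1s
  have hafter : ∀ x ∈ I01, p < x → f x ≤ F x := by
    intro x hx hpx
    rcases hx.2.lt_or_eq with h | h
    · by_contra! hlt
      exact absurd (le_csSup hSb (⟨⟨hx.1, h⟩, hlt.le⟩ : x ∈ S)) (not_le.2 hpx)
    · rw [h, classC.one hf]
      exact le_max_of_le_right (by simp)
  have hpt : ∀ x ∈ Icc (0 : ℝ) 1, F x ^ 2 + 2 * F p * (f x - F x) ≤ f x ^ 2 := by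
    intro x hx
    have : 0 ≤ (f x - F x) * (F x - F p) := by
      rcases lt_trichotomy x p with h | h | h
      · exact mul_nonneg (sub_nonneg.2 (hbefore x hx h)) (sub_nonneg.2 (hFanti h.le))
      · rw [h, sub_self, mul_zero]
      · exact mul_nonneg_of_nonpos_of_nonpos (sub_nonpos.2 (hafter x hx h))
          (sub_nonpos.2 (hFanti h.le))
    nlinarith [sq_nonneg (f x - F x)]
  have hfi := classC.intervalIntegrable hf
  have hFi : IntervalIntegrable F volume 0 1 := hFcont.intervalIntegrable 0 1
  have hF2i : IntervalIntegrable (fun x => F x ^ 2) volume 0 1 :=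
    (hFcont.pow 2).intervalIntegrable 0 1
  have hf2i : IntervalIntegrable (fun x => f x ^ 2) volume 0 1 :=
    ContinuousOn.intervalIntegrable (by
      rw [uIcc_of_le zero_le_one]; exact (classC.cont hf).pow 2)
  have hmono := intervalIntegral.integral_mono_on zero_le_one
    (hF2i.add ((hfi.sub hFi).const_mul (2 * F p))) hf2i hpt
  rw [intervalIntegral.integral_add hF2i ((hfi.sub hFi).const_mul (2 * F p)),
    intervalIntegral.integral_const_mul, intervalIntegral.integral_sub hfi hFi, hF1, hF2] at hmono
  have hzero : (∫ x in (0 : ℝ)..1, f x) - (1 / 2 - 2 * t) = 0 := by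
    change area f - _ = 0
    rw [ht]
    ring
  rw [hzero, mul_zero, add_zero] at hmono
  have hAt : area f = 1 / 2 - 2 * t := by rw [ht]; ring
  rw [hAt]
  nlinarith [sq_nonneg (50 * t - 7)]

end AreaBound

/-! ### The canonical iterates -/

section Iterates

lemma canonicalIterate_succ (n : ℕ) : canonicalIterate (n + 1) = T (canonicalIterate n) :=
  Function.iterate_succ_apply' T n _

lemma canonicalIterate_one : EqOn (canonicalIterate 1) (fun x => 1 - x) I01 := by
  intro x hx
  have hp : ∀ t ∈ uIcc x 1, pseudoInv (fun _ => 1) t = 1 := by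
    intro t ht
    rw [uIcc_of_le hx.2] at ht
    exact le_antisymm (pseudoInv_mem ht.2).2 (le_pseudoInv one_mem ht.2)
  change T (fun _ => 1) x = 1 - x
  rw [T, intervalIntegral.integral_congr hp]
  simp [area]

/-- The properties of an iterate `f` that `T` preserves and that place it in `classK`: together
they bound the area and the stride below by `1/5`. -/
structure Admissible (f : ℝ → ℝ) : Prop where
  mem_classD : f ∈ classD
  convexOn : ConvexOn ℝ I01 f
  line_le : ∀ x ∈ I01, 1 - 5 * x ≤ f x
  le_area : 1 / 5 ≤ area f

variable {f g : ℝ → ℝ}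

lemma Admissible.inv_area_le (hf : Admissible f) : (area f)⁻¹ ≤ 5 := by
  have := inv_anti₀ (by norm_num) hf.le_area
  norm_num at this ⊢
  exact this

lemma Admissible.T (hf : Admissible f) : Admissible (T f) := by
  have hA := classC.area_pos hf.mem_classD.1
  refine ⟨T_mem_classD hf.mem_classD.1, T_convexOn hf.mem_classD, fun x hx => ?_, ?_⟩
  · refine le_trans ?_ (one_sub_div_le_T hf.mem_classD.1 hx)
    have := mul_le_mul_of_nonneg_left hf.inv_area_le hx.1
    rw [div_eq_mul_inv]
    linarith
  · rw [area_T hf.mem_classD, le_div_iff₀ (by linarith)]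
    have := two_fifths_area_le hf.mem_classD.1 hf.convexOn hf.line_le hf.le_area
    linarith

lemma mem_classK (hf : f ∈ classC) (hconv : ConvexOn ℝ I01 f)
    (hline : ∀ x ∈ I01, 1 - 5 * x ≤ f x) (hA : 1 / 5 ≤ area f) : f ∈ classK := by
  refine ⟨hf, hconv, le_csSup ⟨1, fun α hα => ?_⟩ ⟨by norm_num, fun x hx => ?_⟩, hA⟩
  · have := hα.2 1 one_mem
    rw [classC.one hf] at this
    linarith
  · linarith [hline x hx]

lemma area_canonicalIterate_one : area (canonicalIterate 1) = 1 / 2 := by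
  have h : ∫ x in (0 : ℝ)..1, (1 - x) = ∫ x in (0 : ℝ)..1, (1 + -1 * x + 0 * x ^ 2) :=
    intervalIntegral.integral_congr fun x _ => by ring
  rw [area_congr canonicalIterate_one, area, h, integral_quadratic]
  norm_num

lemma admissible_canonicalIterate (n : ℕ) : Admissible (canonicalIterate (n + 1)) := by
  induction n with
  | zero =>
    have h := canonicalIterate_one
    have hlin : ConvexOn ℝ I01 (fun x : ℝ => 1 - x) :=
      ⟨convex_Icc 0 1, fun x _ y _ a b _ _ hab => le_of_eq (by
        simp only [smul_eq_mul]
        linear_combination -hab)⟩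
    refine ⟨mem_classD (by simp [h zero_mem]) (by simp [h one_mem]) ?_ ?_, hlin.congr h.symm,
      fun x hx => ?_, ?_⟩
    · exact ContinuousOn.congr (by fun_prop) h
    · intro x hx y hy hxy
      simp only [zero_add, h hx, h hy]
      linarith
    · simp only [zero_add, h hx]
      linarith [hx.1]
    · rw [zero_add, area_canonicalIterate_one]
      norm_num
  | succ n ih =>
    rw [canonicalIterate_succ]
    exact ih.T

/-- A strengthening of `Dominates f g` that `T` preserves: the crossing number is replaced by the
bound on alternations, and `f ≠ g` is required. -/
structure StronglyDominates (f g : ℝ → ℝ) : Prop where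
  left_mem : f ∈ classD
  right_mem : g ∈ classD
  alternations : AtMostTwoAlternations f g
  le : ∀ x ∈ I01, g x ≤ f x
  exists_lt : ∃ x ∈ I01, g x < f x

lemma StronglyDominates.dominates (h : StronglyDominates f g) : Dominates f g :=
  ⟨h.left_mem, h.right_mem,
    crossingNumber_eq_two h.alternations h.left_mem h.right_mem h.exists_lt, h.le⟩

lemma StronglyDominates.T (h : StronglyDominates f g) : StronglyDominates (T f) (T g) := by
  have hA := area_lt_area h.left_mem h.right_mem h.le h.exists_lt
  refine ⟨T_mem_classD h.left_mem.1, T_mem_classD h.right_mem.1,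
    h.alternations.T h.left_mem h.right_mem, T_le_T h.alternations h.left_mem h.right_mem hA, ?_⟩
  obtain ⟨δ, h0, -, h1, h2⟩ := exists_T_lt_T_near_zero h.left_mem h.right_mem hA zero_lt_one
  exact ⟨δ, ⟨h0.le, h1.le⟩, h2⟩

/-- The difference of a linear function and a convex one is concave, so it has no signs
`+, -, +`. -/
lemma atMostTwoAlternations_of_linear (hf : EqOn f (fun x => 1 - x) I01)
    (hg : ConvexOn ℝ I01 g) : AtMostTwoAlternations f g := by
  intro a b ha hb x₀ x₁ x₂ x₃ h0 h01 h12 h23 h3 ha3 ⟨hA, hB, hC⟩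
  have hconc : ConcaveOn ℝ I01 (fun x => (1 - a * x) - b * g x) := by
    have hlin : ConcaveOn ℝ I01 (fun x : ℝ => 1 - a * x) :=
      ⟨convex_Icc 0 1, fun x _ y _ c d _ _ hcd => le_of_eq (by
        simp only [smul_eq_mul]
        linear_combination hcd)⟩
    exact hlin.sub (hg.smul hb.le)
  have heq : ∀ x, 0 ≤ x → x ≤ x₃ → f (a * x) - b * g x = (1 - a * x) - b * g x := fun x hx hx' => by
    rw [hf ⟨mul_nonneg ha.le hx, (mul_le_mul_of_nonneg_left hx' ha.le).trans ha3⟩]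
  rw [heq x₀ h0 (by linarith), heq x₁ (by linarith) (by linarith)] at hA
  rw [heq x₁ (by linarith) (by linarith), heq x₂ (by linarith) (by linarith)] at hB
  rw [heq x₂ (by linarith) (by linarith), heq x₃ (by linarith) le_rfl] at hC
  have hmin : ∀ u v w, 0 ≤ u → u < v → v < w → w ≤ 1 → 0 < (1 - a * u) - b * g u →
      (1 - a * v) - b * g v < 0 → 0 < (1 - a * w) - b * g w → False := by
    intro u v w hu huv hvw hw p q r
    have := hconc.min_le_of_mem_Icc (x := u) (y := w) (z := v) ⟨hu, by linarith⟩
      ⟨by linarith, hw⟩ ⟨huv.le, hvw.le⟩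
    exact absurd (lt_of_lt_of_le (lt_min p r) this) (not_lt.2 q.le)
  rcases mul_neg_iff.1 hA with ⟨p0, p1⟩ | ⟨p0, p1⟩
  · exact hmin x₀ x₁ x₂ h0 h01 h12 (by linarith) p0 p1 (pos_of_mul_neg_right hB p1.le)
  · have p2 := neg_of_mul_neg_right hB p1.le
    exact hmin x₁ x₂ x₃ (by linarith) h12 h23 h3 p1 p2 (pos_of_mul_neg_right hC p2.le)

lemma stronglyDominates_canonicalIterate (n : ℕ) :
    StronglyDominates (canonicalIterate (n + 1)) (canonicalIterate (n + 2)) := by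
  induction n with
  | zero =>
    have hf := (admissible_canonicalIterate 0).mem_classD
    have hg := admissible_canonicalIterate 1
    have heq := canonicalIterate_one
    refine ⟨hf, hg.mem_classD, atMostTwoAlternations_of_linear heq hg.convexOn,
      fun x hx => ?_, ?_⟩
    · rw [heq hx]
      exact le_one_sub_of_convexOn hg.mem_classD.1 hg.convexOn hx
    · -- the areas are `1/2` and `1/3`
      by_contra! hcon
      have hle : area (canonicalIterate 1) ≤ area (T (canonicalIterate 1)) :=
        intervalIntegral.integral_mono_on zero_le_one (classC.intervalIntegrable hf.1)
          (classC.intervalIntegrable (T_mem_classD hf.1).1) fun x hx => by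
            rw [← canonicalIterate_succ]; exact hcon x hx
      have hsq : ∫ x in (0 : ℝ)..1, canonicalIterate 1 x ^ 2 = 1 / 3 := by
        have h : ∫ x in (0 : ℝ)..1, canonicalIterate 1 x ^ 2 =
            ∫ x in (0 : ℝ)..1, (1 + -2 * x + 1 * x ^ 2) := by
          refine intervalIntegral.integral_congr fun x hx => ?_
          rw [uIcc_of_le zero_le_one] at hx
          simp only [heq hx]
          ring
        rw [h, integral_quadratic]
        norm_num
      rw [area_T hf, area_canonicalIterate_one] at hle
      simp only [zero_add] at hle
      rw [hsq] at hle
      norm_num at hle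
  | succ n ih =>
    rw [canonicalIterate_succ (n + 1), canonicalIterate_succ n.succ.succ]
    exact ih.T

lemma canonicalIterate_antitone {x : ℝ} (hx : x ∈ I01) :
    Antitone fun n => canonicalIterate n x := by
  refine antitone_nat_of_succ_le fun n => ?_
  cases n with
  | zero => exact classC.le_one (admissible_canonicalIterate 0).mem_classD.1 hx
  | succ n => exact (stronglyDominates_canonicalIterate n).le x hx

lemma canonicalIterate_nonneg {x : ℝ} (hx : x ∈ I01) (n : ℕ) : 0 ≤ canonicalIterate n x := by
  cases n with
  | zero => exact zero_le_one
  | succ n => exact classC.nonneg (admissible_canonicalIterate n).mem_classD.1 hx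

end Iterates

/-! ### The limit -/

section Limit

variable {u : ℕ → ℝ → ℝ} {h : ℝ → ℝ}

lemma tendsto_integral_of_bounded {F : ℕ → ℝ → ℝ} {φ : ℝ → ℝ}
    (hF : ∀ n, IntervalIntegrable (F n) volume 0 1) (hF01 : ∀ n, ∀ x ∈ I01, F n x ∈ I01)
    (hlim : ∀ x ∈ I01, Tendsto (fun n => F n x) atTop (𝓝 (φ x))) {x : ℝ} (hx : x ∈ I01) :
    Tendsto (fun n => ∫ t in x..1, F n t) atTop (𝓝 (∫ t in x..1, φ t)) := by
  have hsub : ∀ t ∈ uIoc x 1, t ∈ I01 := fun t ht => by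
    rw [uIoc_of_le hx.2] at ht
    exact ⟨hx.1.trans ht.1.le, ht.2⟩
  refine intervalIntegral.tendsto_integral_filter_of_dominated_convergence (fun _ => 1)
    (Eventually.of_forall fun n => ?_) (Eventually.of_forall fun n => ?_)
    intervalIntegrable_const (Eventually.of_forall fun t ht => hlim t (hsub t ht))
  · exact (intervalIntegrable_of_I01 (hF n) hx one_mem).aestronglyMeasurable_restrict_uIoc
  · refine Eventually.of_forall fun t ht => ?_
    have := hF01 n t (hsub t ht)
    rw [Real.norm_of_nonneg this.1]
    exact this.2

/-- Along a decreasing sequence the pseudo-inverses converge pointwise: if `L` is the limit of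
`u n* y`, then `y ≤ u n (u n* y) ≤ u n L` for all `n`, so `L ≤ h* y`. -/
lemma tendsto_pseudoInv (hu : ∀ n, u n ∈ classC) (hanti : ∀ x ∈ I01, Antitone fun n => u n x)
    (hh : h ∈ classC) (hlim : ∀ x ∈ I01, Tendsto (fun n => u n x) atTop (𝓝 (h x))) {y : ℝ}
    (hy : y ∈ I01) : Tendsto (fun n => pseudoInv (u n) y) atTop (𝓝 (pseudoInv h y)) := by
  have hy0 : ∀ {f : ℝ → ℝ}, f ∈ classC → y ≤ f 0 := fun hf => classC.zero hf ▸ hy.2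
  have hmono : Antitone fun n => pseudoInv (u n) y := fun n k hnk =>
    pseudoInv_mono (fun x hx => hanti x hx hnk) (hy0 (hu k))
  have hbelow : ∀ n, pseudoInv h y ≤ pseudoInv (u n) y := fun n =>
    pseudoInv_mono (fun x hx => (hanti x hx).le_of_tendsto (hlim x hx) n) (hy0 hh)
  have hbdd : BddBelow (range fun n => pseudoInv (u n) y) :=
    ⟨pseudoInv h y, by rintro _ ⟨n, rfl⟩; exact hbelow n⟩
  have hL := tendsto_atTop_ciInf hmono hbdd
  set L := ⨅ n, pseudoInv (u n) y
  have hLge : pseudoInv h y ≤ L := le_ciInf hbelow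
  have hLle : ∀ n, L ≤ pseudoInv (u n) y := fun n => ciInf_le hbdd n
  have hLI : L ∈ I01 := ⟨(classC.pinv_mem hh hy).1.trans hLge,
    (hLle 0).trans (classC.pinv_mem (hu 0) hy).2⟩
  have hyL : y ≤ h L := by
    refine ge_of_tendsto' (hlim L hLI) fun n => ?_
    calc y = u n (pseudoInv (u n) y) := (apply_pseudoInv (hu n) hy).symm
      _ ≤ u n L := classC.anti (hu n) hLI (classC.pinv_mem (hu n) hy) (hLle n)
  rwa [le_antisymm hLge (le_pseudoInv hLI hyL)]

/-- `T` is continuous along decreasing sequences in `classC`. -/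
lemma tendsto_T (hu : ∀ n, u n ∈ classC) (hanti : ∀ x ∈ I01, Antitone fun n => u n x)
    (hh : h ∈ classC) (hlim : ∀ x ∈ I01, Tendsto (fun n => u n x) atTop (𝓝 (h x))) {x : ℝ}
    (hx : x ∈ I01) : Tendsto (fun n => T (u n) x) atTop (𝓝 (T h x)) := by
  refine Tendsto.div ?_ ?_ (classC.area_pos hh).ne'
  · exact tendsto_integral_of_bounded
      (fun n => pseudoInv_intervalIntegrable (hu n) zero_mem one_mem)
      (fun n y hy => classC.pinv_mem (hu n) hy)
      (fun y hy => tendsto_pseudoInv hu hanti hh hlim hy) hx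
  · exact tendsto_integral_of_bounded (fun n => classC.intervalIntegrable (hu n))
      (fun n y hy => ⟨classC.nonneg (hu n) hy, classC.le_one (hu n) hy⟩) hlim zero_mem

lemma solvesIDE_of_fixedPoint (hh : h ∈ classC) (hfix : EqOn (T h) h I01) :
    SolvesIDE (area h) h := by
  have hD : h ∈ classD :=
    ⟨hh, fun x hx y hy hxy => by
      rw [← hfix hx, ← hfix hy]
      exact T_strictAntiOn hh hx hy hxy⟩
  have hder : ∀ x ∈ I01, HasDerivWithinAt h (-pseudoInv h x / area h) I01 x := fun x hx =>
    (hasDerivWithinAt_T hD hx).congr (fun y hy => (hfix hy).symm) (hfix hx).symm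
  have hsurj : SurjOn h I01 I01 := fun y hy =>
    ⟨pseudoInv h y, classC.pinv_mem hh hy, apply_pseudoInv hh hy⟩
  refine ⟨classC.area_pos hh, ⟨fun x hx => ⟨classC.nonneg hh hx, classC.le_one hh hx⟩,
    hD.2.injOn, hsurj⟩, fun x hx => (hder x hx).differentiableWithinAt, fun x hx => ?_⟩
  rw [(hder x hx).derivWithin (uniqueDiffOn_Icc zero_lt_one x hx)]
  have hinv : Function.invFunOn h I01 x = pseudoInv h x := by
    obtain ⟨h1, h2⟩ := Function.invFunOn_pos (hsurj hx)
    exact hD.2.injOn h1 (classC.pinv_mem hh hx) (h2.trans (apply_pseudoInv hh hx).symm)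
  rw [hinv]
  have := (classC.area_pos hh).ne'
  field_simp

end Limit

end Stribola

theorem mainTheorem1 :
    (∀ n : ℕ, 1 ≤ n →
      Stribola.Dominates (Stribola.canonicalIterate n) (Stribola.canonicalIterate (n + 1)) ∧
      Stribola.canonicalIterate n ∈ Stribola.classK) ∧
    ∃ h : ℝ → ℝ,
      h ∈ Stribola.classK ∧
      TendstoUniformlyOn Stribola.canonicalIterate h Filter.atTop (Set.Icc (0 : ℝ) 1) ∧
      Set.EqOn (Stribola.T h) h (Set.Icc (0 : ℝ) 1) ∧
      Stribola.SolvesIDE (Stribola.area h) h := by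
  open Stribola in
  refine ⟨fun n hn => ?_, ?_⟩
  · obtain ⟨k, rfl⟩ := Nat.exists_eq_add_of_le' hn
    have hk := admissible_canonicalIterate k
    exact ⟨(stronglyDominates_canonicalIterate k).dominates,
      mem_classK hk.mem_classD.1 hk.convexOn hk.line_le hk.le_area⟩
  · have hadm := admissible_canonicalIterate
    set h : ℝ → ℝ := fun x => ⨅ n, canonicalIterate n x
    have hlim0 : ∀ x ∈ I01, Tendsto (fun n => canonicalIterate n x) atTop (nhds (h x)) :=
      fun x hx => tendsto_atTop_ciInf (canonicalIterate_antitone hx)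
        ⟨0, by rintro _ ⟨n, rfl⟩; exact canonicalIterate_nonneg hx n⟩
    have hlim : ∀ x ∈ I01, Tendsto (fun n => canonicalIterate (n + 1) x) atTop (nhds (h x)) :=
      fun x hx => (hlim0 x hx).comp (tendsto_add_atTop_nat 1)
    have hlim2 : ∀ x ∈ I01, Tendsto (fun n => T (canonicalIterate (n + 1)) x) atTop
        (nhds (h x)) := fun x hx => by
      simp only [← canonicalIterate_succ]
      exact (hlim0 x hx).comp (tendsto_add_atTop_nat 2)
    have hlip : ∀ x ∈ I01, ∀ y ∈ I01, |h x - h y| ≤ 5 * |x - y| := fun x hx y hy =>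
      le_of_tendsto' ((hlim2 x hx).sub (hlim2 y hy)).abs fun n =>
        (T_lipschitz (hadm n).mem_classD.1 hx hy).trans
          (mul_le_mul_of_nonneg_right (hadm n).inv_area_le (abs_nonneg _))
    have hcont : ContinuousOn h I01 := continuousOn_of_lipschitz hlip
    have harea : Tendsto (fun n => area (canonicalIterate (n + 1))) atTop (nhds (area h)) :=
      tendsto_integral_of_bounded (fun n => classC.intervalIntegrable (hadm n).mem_classD.1)
        (fun n x hx => ⟨classC.nonneg (hadm n).mem_classD.1 hx,
          classC.le_one (hadm n).mem_classD.1 hx⟩) hlim zero_mem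
    have hA : 1 / 5 ≤ area h := ge_of_tendsto' harea fun n => (hadm n).le_area
    have h0 : h 0 = 1 := tendsto_nhds_unique (hlim 0 zero_mem)
      (tendsto_const_nhds.congr fun n => (classC.zero (hadm n).mem_classD.1).symm)
    have h1 : h 1 = 0 := tendsto_nhds_unique (hlim 1 one_mem)
      (tendsto_const_nhds.congr fun n => (classC.one (hadm n).mem_classD.1).symm)
    have hC : h ∈ classC := by
      refine ⟨⟨fun x hx => ?_, fun x hx y hy hxy => ?_, h0, by linarith⟩, hcont, h1⟩
      · exact ge_of_tendsto' (hlim x hx) fun n => classC.nonneg (hadm n).mem_classD.1 hx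
      · exact le_of_tendsto_of_tendsto' (hlim y hy) (hlim x hx) fun n =>
          classC.anti (hadm n).mem_classD.1 hx hy hxy
    have hconv : ConvexOn ℝ I01 h := by
      refine ⟨convex_Icc 0 1, fun x hx y hy a b ha hb hab => ?_⟩
      exact le_of_tendsto_of_tendsto' (hlim _ (convex_Icc 0 1 hx hy ha hb hab))
        (((hlim x hx).const_smul a).add ((hlim y hy).const_smul b))
        fun n => (hadm n).convexOn.2 hx hy ha hb hab
    have hfix : EqOn (T h) h I01 := fun x hx =>
      tendsto_nhds_unique (tendsto_T (fun n => (hadm n).mem_classD.1)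
        (fun y hy => (canonicalIterate_antitone hy).comp_monotone fun _ _ hab =>
          Nat.add_le_add_right hab 1) hC hlim hx) (hlim2 x hx)
    refine ⟨h, mem_classK hC hconv (fun x hx => ?_) hA, ?_, hfix, solvesIDE_of_fixedPoint hC hfix⟩
    · exact ge_of_tendsto' (hlim x hx) fun n => (hadm n).line_le x hx
    · refine Antitone.tendstoUniformlyOn_of_forall_tendsto isCompact_Icc (fun n => ?_)
        (fun x hx => canonicalIterate_antitone hx) hcont hlim0
      cases n with
      | zero => exact continuousOn_const
      | succ n => exact classC.cont (hadm n).mem_classD.1
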